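/- Let $\mathbb K=\mathbb R$ or $\mathbb C$, and let $X$ be a Banach space over $\mathbb K$ consisting of classes (modulo equality a.e.) of integrable functions on $[0,1]$ with Lebesgue measure $\mu$. Suppose that $X$ is a Köthe function space: if $f$ is measurable, $g\in X$ and $|f|\le |g|$ a.e., then $f\in X$ and $\|f\|\le\|g\|$; and $\mathbf 1_A\in X$ for every measurable $A$. Let $X'\subset X^*$ be the space of functionals of the form $f\mapsto\int_0^1 fg\,d\mu$, where $g$ is measurable and $fg\in L_1[0,1]$ for all $f\in X$, with the norm of $X^*$; identify such functionals with the functions $g$, so that $X'$ is again a Köthe function space, and put $X''=(X')'$. Suppose that $X$ is rearrangement invariant, that is: 1. if $\tau:[0,1]\to[0,1]$ is a measure-preserving bijection and $f$ is integrable, then $f\in X$ if and only if $f\circ\tau^{-1}\in X$, and in this case $\|f\|=\|f\circ\tau^{-1}\|$; 2. $X'$ is norming, i.e. $\|f\|=\sup\{|x^*(f)|: x^*\in X',\ \|x^*\|\le 1\}$ for all $f\in X$, and, as a subspace of $X''$, either $X=X''$ or $X$ is the closed linear span in $X''$ of the simple functions of $X''$; 3. $L_\infty[0,1]\subset X\subset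 L_1[0,1]$ with $\|f\|_X\le\|f\|_\infty$ for $f\in L_\infty[0,1]$ and $\|f\|_1\le\|f\|_X$ for $f\in X$. Suppose further that $X$ is separable and lush: for all $x,y\in X$ with $\|x\|=\|y\|=1$ and every $\varepsilon>0$ there is $x^*\in X^*$ with $\|x^*\|=1$ such that $x\in S:=\{z\in B_X:\operatorname{Re}x^*(z)>1-\varepsilon\}$ and the distance from $y$ to the closed absolutely convex hull of $S$ is less than $\varepsilon$, where $B_X$ is the closed unit ball of $X$. Then $X=L_1[0,1]$: the elements of $X$ are exactly the classes of integrable functions, and $\|f\|_X=\int_0^1|f|\,d\mu$ for every $f\in X$. -/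

import Mathlib

open MeasureTheory Set
open scoped ENNReal ComplexOrder unitInterval

noncomputable section

namespace RISpace

section Kothe

variable {𝕜 : Type*} [RCLike 𝕜] {Ω : Type*} [MeasurableSpace Ω] {μ : Measure Ω}
  {X : Type*} [NormedAddCommGroup X] [NormedSpace 𝕜 X]

/-- A Banach space `X` whose elements are (through the injective linear map `ι`, sending an element
to the class it is) classes modulo a.e. equality of locally integrable `𝕜`-valued functions on
`(Ω, μ)` is a *Köthe function space* if it is solid and contains the characteristic functions of
all sets of finite measure. -/
structure IsKotheFunctionSpace (ι : X →ₗ[𝕜] (Ω →ₘ[μ] 𝕜)) : Prop where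
  injective : Function.Injective ι
  complete : CompleteSpace X
  locallyIntegrable : ∀ (x : X) (A : Set Ω), MeasurableSet A → μ A < ∞ → IntegrableOn (ι x) A μ
  solid : ∀ (f : Ω →ₘ[μ] 𝕜) (x : X), (∀ᵐ t ∂μ, ‖f t‖ ≤ ‖ι x t‖) → ∃ y : X, ι y = f ∧ ‖y‖ ≤ ‖x‖
  indicator_mem : ∀ A : Set Ω, MeasurableSet A → μ A < ∞ →
    ∃ x : X, ι x =ᵐ[μ] A.indicator (fun _ => (1 : 𝕜))

/-- The functional `φ ∈ X*` is the integral functional `x_g^* : f ↦ ∫ f g dμ`, where `g` is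
a measurable function with `g f ∈ L₁(μ)` for all `f ∈ X`. -/
def IsIntegralAgainst (ι : X →ₗ[𝕜] (Ω →ₘ[μ] 𝕜)) (φ : StrongDual 𝕜 X) (g : Ω →ₘ[μ] 𝕜) : Prop :=
  ∀ x : X, Integrable (fun t => ι x t * g t) μ ∧ φ x = ∫ t, ι x t * g t ∂μ

/-- The Köthe dual `X'`: all integrals in `X*`. -/
def kotheDual (ι : X →ₗ[𝕜] (Ω →ₘ[μ] 𝕜)) : Set (StrongDual 𝕜 X) :=
  {φ | ∃ g : Ω →ₘ[μ] 𝕜, IsIntegralAgainst ι φ g}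

/-- The subset `Y` of `X*` is norming: `‖x‖ = sup {|φ(x)| : φ ∈ Y, ‖φ‖ ≤ 1}` for all `x ∈ X`. -/
def IsNorming (Y : Set (StrongDual 𝕜 X)) : Prop :=
  ∀ x : X, IsLUB {r : ℝ | ∃ φ ∈ Y, ‖φ‖ ≤ 1 ∧ r = ‖φ x‖} ‖x‖

/-- The second Köthe dual `X''` as a set of classes of functions: the measurable `h` with
`h g ∈ L₁(μ)` for all `g ∈ X'`. -/
def kotheBidual (ι : X →ₗ[𝕜] (Ω →ₘ[μ] 𝕜)) : Set (Ω →ₘ[μ] 𝕜) :=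
  {h | ∀ (φ : StrongDual 𝕜 X) (g : Ω →ₘ[μ] 𝕜), IsIntegralAgainst ι φ g →
    Integrable (fun t => g t * h t) μ}

/-- The norm of `h ∈ X''`, that is, the norm of the functional `g ↦ ∫ g h dμ` on `X'`, where `X'`
carries the norm of `X*`. -/
def kotheBidualNorm (ι : X →ₗ[𝕜] (Ω →ₘ[μ] 𝕜)) (h : Ω →ₘ[μ] 𝕜) : ℝ≥0∞ :=
  ⨆ (φ : StrongDual 𝕜 X) (g : Ω →ₘ[μ] 𝕜) (_ : IsIntegralAgainst ι φ g ∧ ‖φ‖ ≤ 1),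
    ‖∫ t, g t * h t ∂μ‖ₑ

/-- The closure in `X''` of the linear space of the simple integrable functions in `X''`. -/
def closureSimpleBidual (ι : X →ₗ[𝕜] (Ω →ₘ[μ] 𝕜)) : Set (Ω →ₘ[μ] 𝕜) :=
  {h | h ∈ kotheBidual ι ∧ ∀ ε : ℝ≥0∞, 0 < ε → ∃ s : SimpleFunc Ω 𝕜, Integrable s μ ∧
    AEEqFun.mk s s.aestronglyMeasurable ∈ kotheBidual ι ∧
    kotheBidualNorm ι (h - AEEqFun.mk s s.aestronglyMeasurable) < ε}

end Kothe

section Rearrangement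

variable {𝕜 : Type*} [RCLike 𝕜] {X : Type*} [NormedAddCommGroup X] [NormedSpace 𝕜 X]

/-- A *rearrangement invariant (r.i.) space* on `[0,1]` with Lebesgue measure. -/
structure IsRearrangementInvariant (ι : X →ₗ[𝕜] (I →ₘ[(volume : Measure I)] 𝕜)) : Prop
    extends IsKotheFunctionSpace ι where
  /-- `f ∈ X` iff `f ∘ τ⁻¹ ∈ X`, for all measure-preserving bijections `τ` -/
  comp_mem_iff : ∀ (τ : I ≃ᵐ I) (hτ : MeasurePreserving τ.symm volume volume)
    (f : I →ₘ[(volume : Measure I)] 𝕜), Integrable f volume →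
      (f ∈ range ι ↔ f.compMeasurePreserving τ.symm hτ ∈ range ι)
  /-- `‖f ∘ τ⁻¹‖ = ‖f‖` -/
  norm_comp : ∀ (τ : I ≃ᵐ I) (hτ : MeasurePreserving τ.symm volume volume) (x y : X),
    ι y = (ι x).compMeasurePreserving τ.symm hτ → ‖y‖ = ‖x‖
  norming : IsNorming (kotheDual ι)
  bidual : range ι = kotheBidual ι ∨ range ι = closureSimpleBidual ι
  /-- `L_∞ ⊆ X`, with inclusion of norm at most one -/
  linfty_le : ∀ f : I →ₘ[(volume : Measure I)] 𝕜, MemLp f ∞ volume →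
    ∃ x : X, ι x = f ∧ ‖x‖ₑ ≤ eLpNorm f ∞ volume
  /-- `X ⊆ L_1`, with inclusion of norm at most one -/
  le_lone : ∀ x : X, MemLp (ι x) 1 volume ∧ eLpNorm (ι x) 1 volume ≤ ‖x‖ₑ

end Rearrangement

section Lush

variable {𝕜 : Type*} [RCLike 𝕜] {X : Type*} [NormedAddCommGroup X] [NormedSpace 𝕜 X]

/-- The slice `S(B, φ, α) = {x ∈ B : Re φ(x) > sup Re φ(B) - α}`. -/
def slice (B : Set X) (φ : StrongDual 𝕜 X) (α : ℝ) : Set X :=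
  {x | x ∈ B ∧ sSup ((fun z => RCLike.re (φ z)) '' B) - α < RCLike.re (φ x)}

variable (𝕜 X) in
/-- Lushness of the Banach space `X` over `𝕜`. -/
def IsLush : Prop :=
  ∀ x y : X, ‖x‖ = 1 → ‖y‖ = 1 → ∀ ε : ℝ, 0 < ε →
    ∃ φ : StrongDual 𝕜 X, ‖φ‖ = 1 ∧ x ∈ slice (Metric.closedBall 0 1) φ ε ∧
      Metric.infDist y (closedAbsConvexHull 𝕜 (slice (Metric.closedBall 0 1) φ ε)) < ε

end Lush

end RISpace

end

/-! Since `‖f‖₁ ≤ ‖f‖` for `f ∈ X`, the reverse inequality is needed on `X`; completeness then shows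
that `X` contains every integrable function.

Call a functional of norm at most one a spear if every functional almost attains its norm on each of
its slices of the ball. Lushness handles one vector `y` at a time; with separability, an iteration
over a dense sequence and weak* compactness produce a spear that almost attains the norm of any
given unit vector (`IsLush.exists_isSpear`). Separability and the norming Köthe dual also make the
norm order continuous (`tendsto_norm_cut`), so each functional is integration against a density
(`exists_density`).

The heart is that the density `g` of a spear is unimodular (`IsSpearDensity.norm_eq_one`). Suppose
`|g| ≤ a < 1` on a set of positive measure. Split `[0,1]` into many small parts on which `|g|` has
nearly the same distribution. Some part carries the norm of `g` by itself
(`IsSpearDensity.isFull_or`). Copy that part of `g` by a measure-preserving bijection onto a small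
set `C` where `|g| ≤ a`. The spear property gives a `z` in the ball that almost norms both `g` and
the copy. As `g` is small on `C`, the integral of `|z g|` off `C` is not small, while `z` restricted
to `C` nearly exhausts the copy. Rearranging `z` so that its piece on `C` faces a part of `g` of
negligible cost adds the two contributions and gives a total above one.

Once `|g| = 1` a.e., every spear satisfies `|φ(x)| ≤ ‖x‖₁`. Spears being norming, `‖x‖ ≤ ‖x‖₁`. -/

noncomputable section

namespace RISpace

/-! ### Spear functionals in separable lush spaces. -/

section Spear

open Filter Topology

variable {𝕜 : Type*} [RCLike 𝕜] {X : Type*} [NormedAddCommGroup X] [NormedSpace 𝕜 X]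

/-- A functional `φ` in the dual ball such that, for every functional `h`, the norm of `h` is
almost attained on each slice of the ball given by `φ`. -/
def IsSpear (φ : StrongDual 𝕜 X) : Prop :=
  ‖φ‖ ≤ 1 ∧ ∀ (h : StrongDual 𝕜 X) (δ : ℝ), 0 < δ →
    ∃ z : X, ‖z‖ ≤ 1 ∧ 1 - δ < RCLike.re (φ z) ∧ ‖h‖ - δ < ‖h z‖

lemma re_apply_le (φ : StrongDual 𝕜 X) (z : X) : RCLike.re (φ z) ≤ ‖φ‖ * ‖z‖ :=
  (RCLike.re_le_norm _).trans (φ.le_opNorm z)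

lemma norm_le_sSup_re (φ : StrongDual 𝕜 X) :
    ‖φ‖ ≤ sSup ((fun z => RCLike.re (φ z)) '' Metric.closedBall 0 1) := by
  refine le_of_forall_lt fun r hr => ?_
  obtain ⟨z, hz, hrz⟩ := φ.exists_lt_apply_of_lt_opNorm hr
  obtain ⟨c, hc, hcz⟩ := RCLike.exists_norm_eq_mul_self (φ z)
  have hb : BddAbove ((fun z => RCLike.re (φ z)) '' Metric.closedBall 0 1) := by
    refine ⟨‖φ‖, ?_⟩
    rintro _ ⟨z, hz, rfl⟩
    have hz : ‖z‖ ≤ 1 := by simpa using hz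
    exact (re_apply_le φ z).trans (mul_le_of_le_one_right (norm_nonneg _) hz)
  refine hrz.trans_le (le_csSup_of_le hb (mem_image_of_mem _ (?_ : c • z ∈ _)) ?_)
  · simpa [norm_smul, hc] using hz.le
  · simp [← hcz]

/-- Every point of the absolutely convex hull of `S` has a companion in the convex hull of `S` such
that the values of functionals at both are controlled by their values at a single point of `S`. -/
lemma exists_companion {S : Set X} {φ : StrongDual 𝕜 X} {r : ℝ} (hSb : ∀ z ∈ S, ‖z‖ ≤ 1)
    (hSr : ∀ z ∈ S, r < RCLike.re (φ z)) {p : X} (hp : p ∈ absConvexHull 𝕜 S) :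
    ∃ w : X, ‖w‖ ≤ 1 ∧ r < RCLike.re (φ w) ∧ ∀ ψ h : StrongDual 𝕜 X,
      ∃ z ∈ S, ‖h p‖ + RCLike.re (ψ w) ≤ ‖h z‖ + RCLike.re (ψ z) := by
  let T : Set X := {p | ∃ w : X, ‖w‖ ≤ 1 ∧ r < RCLike.re (φ w) ∧ ∀ ψ h : StrongDual 𝕜 X,
      ∃ z ∈ S, ‖h p‖ + RCLike.re (ψ w) ≤ ‖h z‖ + RCLike.re (ψ z)}
  suffices absConvexHull 𝕜 S ⊆ T from this hp
  -- `T` is balanced because shrinking `p` leaves its companion `w` valid, and convex because the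
  -- same weights can be applied to the companions: the weighted average of `‖h ·‖ + Re ψ` is at
  -- most its larger value.
  refine absConvexHull_min (fun z hz => ⟨z, hSb z hz, hSr z hz, fun _ _ => ⟨z, hz, le_rfl⟩⟩)
    ⟨balanced_iff_smul_mem.2 ?_, ?_⟩
  · rintro c hc p ⟨w, hw, hr, H⟩
    refine ⟨w, hw, hr, fun ψ h => ?_⟩
    obtain ⟨z, hz, hle⟩ := H ψ h
    refine ⟨z, hz, le_trans ?_ hle⟩
    rw [map_smul, norm_smul]
    gcongr
    exact mul_le_of_le_one_left (norm_nonneg _) hc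
  · rintro p ⟨w, hw, hr, H⟩ p' ⟨w', hw', hr', H'⟩ a b ha hb hab
    obtain ⟨s, rfl⟩ : ∃ s : ℝ, (s : 𝕜) = a :=
      ⟨RCLike.re a, (RCLike.ext (by simp) (by simp [(RCLike.nonneg_iff.1 ha).2]))⟩
    obtain ⟨t, rfl⟩ : ∃ s : ℝ, (s : 𝕜) = b :=
      ⟨RCLike.re b, (RCLike.ext (by simp) (by simp [(RCLike.nonneg_iff.1 hb).2]))⟩
    have hs : 0 ≤ s := by simpa using ha
    have ht : 0 ≤ t := by simpa using hb
    have hst : s + t = 1 := by exact_mod_cast hab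
    refine ⟨(s : 𝕜) • w + (t : 𝕜) • w', ?_, ?_, fun ψ h => ?_⟩
    · refine (norm_add_le _ _).trans ?_
      rw [norm_smul, norm_smul, RCLike.norm_of_nonneg hs, RCLike.norm_of_nonneg ht]
      nlinarith
    · simp only [map_add, map_smul, smul_eq_mul, RCLike.re_ofReal_mul]
      rcases hs.eq_or_lt with rfl | hs
      · obtain rfl : t = 1 := by linarith
        simpa using hr'
      · have h1 := mul_lt_mul_of_pos_left hr hs
        have h2 := mul_le_mul_of_nonneg_left hr'.le ht
        have h3 : s * r + t * r = r := by rw [← add_mul, hst, one_mul]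
        linarith
    · obtain ⟨z, hz, hle⟩ := H ψ h
      obtain ⟨z', hz', hle'⟩ := H' ψ h
      have key : ‖h ((s : 𝕜) • p + (t : 𝕜) • p')‖ +
          RCLike.re (ψ ((s : 𝕜) • w + (t : 𝕜) • w')) ≤
          s * (‖h p‖ + RCLike.re (ψ w)) + t * (‖h p'‖ + RCLike.re (ψ w')) := by
        have := norm_add_le ((s : 𝕜) * h p) ((t : 𝕜) * h p')
        rw [norm_mul, norm_mul, RCLike.norm_of_nonneg hs, RCLike.norm_of_nonneg ht] at this
        simp only [map_add, map_smul, smul_eq_mul, RCLike.re_ofReal_mul]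
        linarith
      have hmax : ∀ M, ‖h z‖ + RCLike.re (ψ z) ≤ M → ‖h z'‖ + RCLike.re (ψ z') ≤ M →
          ‖h ((s : 𝕜) • p + (t : 𝕜) • p')‖ + RCLike.re (ψ ((s : 𝕜) • w + (t : 𝕜) • w')) ≤ M := by
        intro M hM hM'
        have h1 := mul_le_mul_of_nonneg_left (hle.trans hM) hs
        have h2 := mul_le_mul_of_nonneg_left (hle'.trans hM') ht
        have h3 : s * M + t * M = M := by rw [← add_mul, hst, one_mul]
        linarith
      rcases le_total (‖h z‖ + RCLike.re (ψ z)) (‖h z'‖ + RCLike.re (ψ z')) with hzz | hzz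
      · exact ⟨z', hz', hmax _ hzz le_rfl⟩
      · exact ⟨z, hz, hmax _ le_rfl hzz⟩

lemma IsLush.exists_companion (hX : IsLush 𝕜 X) {x y : X} (hx : ‖x‖ = 1) (hy : ‖y‖ = 1) {ε : ℝ}
    (hε : 0 < ε) : ∃ (φ : StrongDual 𝕜 X) (w p : X), ‖φ‖ = 1 ∧ 1 - ε < RCLike.re (φ x) ∧
      1 - ε < RCLike.re (φ w) ∧ ‖w‖ ≤ 1 ∧ ‖y - p‖ < ε ∧ ∀ ψ h : StrongDual 𝕜 X,
        ∃ z : X, ‖z‖ ≤ 1 ∧ ‖h p‖ + RCLike.re (ψ w) ≤ ‖h z‖ + RCLike.re (ψ z) := by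
  obtain ⟨φ, hφ, hxS, hd⟩ := hX x y hx hy ε hε
  have hsup := norm_le_sSup_re φ
  rw [hφ] at hsup
  have hne : (absConvexHull 𝕜 (slice (Metric.closedBall 0 1) φ ε)).Nonempty :=
    ⟨x, subset_absConvexHull hxS⟩
  rw [closedAbsConvexHull_eq_closure_absConvexHull, Metric.infDist_closure,
    Metric.infDist_lt_iff hne] at hd
  obtain ⟨p, hp, hyp⟩ := hd
  obtain ⟨w, hw, hr, H⟩ := RISpace.exists_companion (r := 1 - ε) (φ := φ)
    (fun z hz => by simpa using hz.1) (fun z hz => by have := hz.2; linarith) hp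
  refine ⟨φ, w, p, hφ, by have := hxS.2; linarith, hr, hw, by rwa [← dist_eq_norm], fun ψ h => ?_⟩
  obtain ⟨z, hz, hle⟩ := H ψ h
  exact ⟨z, by simpa using hz.1, hle⟩

lemma exists_unit_lt_norm_apply [Nontrivial X] (h : StrongDual 𝕜 X) {r : ℝ} (hr : r < ‖h‖) :
    ∃ y : X, ‖y‖ = 1 ∧ r < ‖h y‖ := by
  obtain ⟨x, hx, hrx⟩ := h.exists_lt_apply_of_lt_opNorm hr
  rcases eq_or_ne x 0 with rfl | hx0
  · obtain ⟨v, hv⟩ := exists_ne (0 : X)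
    have hn := norm_ne_zero_iff.2 hv
    obtain ⟨y, hy⟩ : ∃ y : X, ‖y‖ = 1 := ⟨((‖v‖⁻¹ : ℝ) : 𝕜) • v, by
      rw [norm_smul, RCLike.norm_of_nonneg (by positivity), inv_mul_cancel₀ hn]⟩
    exact ⟨y, hy, by simp at hrx; exact hrx.trans_le (norm_nonneg _)⟩
  · have hn := norm_pos_iff.2 hx0
    refine ⟨((‖x‖⁻¹ : ℝ) : 𝕜) • x, ?_, hrx.trans_le ?_⟩
    · rw [norm_smul, RCLike.norm_of_nonneg (by positivity), inv_mul_cancel₀ hn.ne']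
    · rw [map_smul, norm_smul, RCLike.norm_of_nonneg (by positivity)]
      exact le_mul_of_one_le_left (norm_nonneg _) ((one_le_inv₀ hn).2 hx.le)

/-- The vector `v` is `x + w` normalized, and `‖x + w‖` is nearly 2 because `φ` is nearly 1 at both.
A functional nearly 1 at `v` has a sum of real parts at `x` and `w` close to 2, while neither
exceeds 1. Thus one vector can replace two conditions in the iteration. -/
lemma normalized_sum_spec {x w : X} {φ : StrongDual 𝕜 X} {ε : ℝ} (hφ : ‖φ‖ = 1) (hε : ε < 1)
    (hx : 1 - ε < RCLike.re (φ x)) (hw : 1 - ε < RCLike.re (φ w)) (hx1 : ‖x‖ ≤ 1) (hw1 : ‖w‖ ≤ 1) :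
    ∃ v : X, ‖v‖ = 1 ∧ ∀ (ψ : StrongDual 𝕜 X) (t : ℝ), ‖ψ‖ ≤ 1 → 0 ≤ t → 1 - t ≤ RCLike.re (ψ v) →
      1 - (2 * t + 2 * ε) ≤ RCLike.re (ψ x) ∧ 1 - (2 * t + 2 * ε) ≤ RCLike.re (ψ w) := by
  have hn : 2 - 2 * ε < ‖x + w‖ := by
    have := re_apply_le φ (x + w)
    rw [hφ, one_mul, map_add, map_add] at this
    linarith
  have hpos : 0 < ‖x + w‖ := by linarith
  refine ⟨((‖x + w‖⁻¹ : ℝ) : 𝕜) • (x + w), ?_, fun ψ t hψ ht h => ?_⟩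
  · rw [norm_smul, RCLike.norm_of_nonneg (by positivity), inv_mul_cancel₀ hpos.ne']
  · have hψx : RCLike.re (ψ x) ≤ 1 :=
      (re_apply_le ψ x).trans (mul_le_one₀ hψ (norm_nonneg _) hx1)
    have hψw : RCLike.re (ψ w) ≤ 1 :=
      (re_apply_le ψ w).trans (mul_le_one₀ hψ (norm_nonneg _) hw1)
    have hle : ‖x + w‖ ≤ 2 := (norm_add_le _ _).trans (by linarith)
    rw [map_smul, smul_eq_mul, RCLike.re_ofReal_mul, ← div_eq_inv_mul, le_div_iff₀ hpos, map_add,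
      map_add] at h
    constructor <;> nlinarith

/-- In a separable lush space, the functionals in `IsSpear` are norming. -/
theorem IsLush.exists_isSpear [Nontrivial X] [TopologicalSpace.SeparableSpace X] (hX : IsLush 𝕜 X)
    {x : X} (hx : ‖x‖ = 1) {η : ℝ} (hη : 0 < η) (hη1 : η < 1) :
    ∃ φ : StrongDual 𝕜 X, IsSpear φ ∧ 1 - η ≤ RCLike.re (φ x) := by
  have : SecondCountableTopology X := UniformSpace.secondCountable_of_separable X
  have : Nonempty (Metric.sphere (0 : X) 1) := ⟨⟨x, by simpa using hx⟩⟩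
  let d : ℕ → Metric.sphere (0 : X) 1 := TopologicalSpace.denseSeq _
  -- Unpairing makes every point of the dense sequence occur at arbitrarily late stages, where the
  -- error is arbitrarily small.
  let y : ℕ → X := fun n => d n.unpair.1
  have hy : ∀ n, ‖y n‖ = 1 := fun n => mem_sphere_zero_iff_norm.1 (d n.unpair.1).2
  let e : ℕ → ℝ := fun n => η / 4 ^ n
  have he : ∀ n, 0 < e n := fun n => by positivity
  have he1 : ∀ n, e n < 1 := fun n =>
    (div_le_self hη.le (one_le_pow₀ (by norm_num))).trans_lt hη1
  -- The ratio 4 suits `normalized_sum_spec`: with `t` and `ε` both equal to `e n / 4`, the loss `2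
  -- * t + 2 * ε` is exactly `e n`.
  have hes : ∀ n, e (n + 1) = e n / 4 := fun n => by simp only [e]; rw [pow_succ]; field_simp
  have step : ∀ (n : ℕ) (x : Metric.sphere (0 : X) 1), ∃ (v : Metric.sphere (0 : X) 1) (w p : X),
      ‖y n - p‖ < e n ∧ (∀ ψ h : StrongDual 𝕜 X,
        ∃ z : X, ‖z‖ ≤ 1 ∧ ‖h p‖ + RCLike.re (ψ w) ≤ ‖h z‖ + RCLike.re (ψ z)) ∧
      ∀ (ψ : StrongDual 𝕜 X), ‖ψ‖ ≤ 1 → 1 - e (n + 1) ≤ RCLike.re (ψ v) →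
        1 - e n ≤ RCLike.re (ψ x) ∧ 1 - e n ≤ RCLike.re (ψ w) := by
    rintro n ⟨x, hx⟩
    have hx : ‖x‖ = 1 := by simpa using hx
    obtain ⟨φ, w, p, hφ, hφx, hφw, hw, hyp, H⟩ := hX.exists_companion hx (hy n)
      (show 0 < e n / 4 by have := he n; positivity)
    obtain ⟨v, hv, hv'⟩ := normalized_sum_spec hφ (by have := he1 n; linarith) hφx hφw hx.le hw
    refine ⟨⟨v, by simpa using hv⟩, w, p, hyp.trans (by have := he n; linarith), H,
      fun ψ hψ h => ?_⟩
    have := hv' ψ (e (n + 1)) hψ (he _).le h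
    rw [hes] at this
    rwa [show 2 * (e n / 4) + 2 * (e n / 4) = e n by ring] at this
  choose v w p hyp H hvw using step
  let xs : ℕ → Metric.sphere (0 : X) 1 := fun n => Nat.rec ⟨x, by simpa using hx⟩ (fun n x => v n x) n
  have hxs (n : ℕ) : ‖(xs n).1‖ = 1 := norm_eq_of_mem_sphere (xs n)
  -- These weak* compact sets decrease, and each contains a functional norming `xs n`. A common
  -- point is nearly 1 at `x` and at every companion `w n (xs n)`.
  let K : ℕ → Set (WeakDual 𝕜 X) := fun n =>
    (WeakDual.toStrongDual ⁻¹' Metric.closedBall 0 1) ∩ {ψ | 1 - e n ≤ RCLike.re (ψ (xs n).1)}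
  have hcl : ∀ n, IsClosed {ψ : WeakDual 𝕜 X | 1 - e n ≤ RCLike.re (ψ (xs n).1)} := fun n =>
    isClosed_le continuous_const (RCLike.continuous_re.comp (WeakDual.eval_continuous _))
  have hcomp : ∀ n, IsCompact (K n) := fun n =>
    (WeakDual.isCompact_closedBall 0 1).inter_right (hcl n)
  obtain ⟨ψ, hψ⟩ : (⋂ n, K n).Nonempty := by
    refine IsCompact.nonempty_iInter_of_sequence_nonempty_isCompact_isClosed K ?_ ?_ (hcomp 0)
      fun n => (hcomp n).isClosed
    · rintro n ψ ⟨hψ, h⟩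
      refine ⟨hψ, (hvw n (xs n) (WeakDual.toStrongDual ψ) (by simpa using hψ) h).1⟩
    · intro n
      obtain ⟨g, hg, hgx⟩ := exists_dual_vector 𝕜 (xs n).1 (by
        rw [← norm_ne_zero_iff, hxs n]; norm_num)
      refine ⟨StrongDual.toWeakDual g, ?_, ?_⟩
      · simp [hg]
      · have : (StrongDual.toWeakDual g) (xs n).1 = g (xs n) := rfl
        rw [mem_ofPred_eq, this, hgx, hxs n]
        simpa using (he n).le
  let φ := WeakDual.toStrongDual ψ
  have hφ1 : ‖φ‖ ≤ 1 := by simpa using (mem_iInter.1 hψ 0).1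
  have hφx : ∀ n, 1 - e n ≤ RCLike.re (φ (xs n).1) := fun n => (mem_iInter.1 hψ n).2
  refine ⟨φ, ⟨hφ1, fun h δ hδ => ?_⟩, ?_⟩
  swap
  · have h0 := hφx 0
    rw [show (xs 0).1 = x from rfl] at h0
    simpa [e] using h0
  obtain ⟨u, hu, hhu⟩ := exists_unit_lt_norm_apply h (show ‖h‖ - δ / 4 < ‖h‖ by linarith)
  obtain ⟨k, hk⟩ : ∃ k, ‖h‖ - δ / 4 < ‖h (d k)‖ := by
    have ho : IsOpen {u : Metric.sphere (0 : X) 1 | ‖h‖ - δ / 4 < ‖h u‖} :=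
      isOpen_lt continuous_const (by fun_prop)
    exact (TopologicalSpace.denseRange_denseSeq _).exists_mem_open ho ⟨⟨u, by simpa using hu⟩, hhu⟩
  have hlim : Tendsto e atTop (𝓝 0) := by
    have := (tendsto_pow_atTop_nhds_zero_of_lt_one (r := (1 / 4 : ℝ)) (by norm_num)
      (by norm_num)).const_mul η
    simpa [e, div_eq_mul_inv] using this
  have hlim' : Tendsto (fun j => (1 + ‖h‖) * e (Nat.pair k j)) atTop (𝓝 ((1 + ‖h‖) * 0)) :=
    (hlim.comp (tendsto_atTop_mono (fun j => Nat.right_le_pair k j) tendsto_id)).const_mul _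
  rw [mul_zero] at hlim'
  obtain ⟨j, hj⟩ := (hlim'.eventually (gt_mem_nhds (show 0 < δ / 4 by positivity))).exists
  set n := Nat.pair k j
  have hyn : y n = d k := by simp [y, n]
  obtain ⟨z, hz, hle⟩ := H n (xs n) φ h
  have h1 : 1 - e n ≤ RCLike.re (φ (w n (xs n))) :=
    (hvw n (xs n) φ hφ1 (hφx (n + 1))).2
  have h2 : ‖h (y n)‖ - ‖h‖ * e n ≤ ‖h (p n (xs n))‖ := by
    have a1 := norm_sub_norm_le (h (y n)) (h (p n (xs n)))
    rw [← map_sub] at a1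
    have a2 := h.le_opNorm (y n - p n (xs n))
    have a3 := mul_le_mul_of_nonneg_left (hyp n (xs n)).le (norm_nonneg h)
    linarith
  rw [hyn] at h2
  have h3 : ‖h z‖ ≤ ‖h‖ := (h.le_opNorm z).trans (mul_le_of_le_one_right (norm_nonneg _) hz)
  have h4 : RCLike.re (φ z) ≤ 1 := (re_apply_le φ z).trans (mul_le_one₀ hφ1 (norm_nonneg _) hz)
  -- `‖h z‖ + Re φ(z)` is within `δ` of its upper bound `‖h‖ + 1`, so each summand is within `δ` of
  -- its own bound.
  exact ⟨z, hz, by nlinarith, by nlinarith⟩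

end Spear

/-! ### Measure-preserving bijections with prescribed level sets. -/

section Transport

/-- The Cantor set is a union of two copies of itself scaled by `1/3`, so its finite measure is at
most `2/3` of itself. -/
lemma volume_cantorSet : volume cantorSet = 0 := by
  have hle : volume cantorSet ≤ 1 := by
    calc volume cantorSet ≤ volume (Icc (0 : ℝ) 1) := measure_mono cantorSet_subset_unitInterval
      _ = 1 := by simp
  have h3 : ∀ (b : ℝ), volume ((fun x => (b + x) / 3) '' cantorSet) ≤
      ENNReal.ofReal (1 / 3) * volume cantorSet := by
    intro b
    have : (fun x : ℝ => (b + x) / 3) '' cantorSet =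
        (fun x => b / 3 + x) '' ((fun x => (1 / 3 : ℝ) • x) '' cantorSet) := by
      rw [image_image]
      congr 1
      ext x
      simp only [smul_eq_mul]
      ring
    rw [this, image_add_left, measure_preimage_add, image_smul, Measure.addHaar_smul]
    simp
  have h2 : volume cantorSet ≤ ENNReal.ofReal (2 / 3) * volume cantorSet := by
    conv_lhs => rw [cantorSet_eq_union_halves]
    have h0 := h3 0
    simp only [zero_add] at h0
    refine (measure_union_le _ _).trans ((add_le_add h0 (h3 2)).trans ?_)
    rw [← add_mul, ← ENNReal.ofReal_add (by norm_num) (by norm_num)]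
    norm_num
  lift volume cantorSet to NNReal using (hle.trans_lt ENNReal.one_lt_top).ne with v
  rw [ENNReal.ofReal, ← ENNReal.coe_mul, ENNReal.coe_le_coe, ← NNReal.coe_le_coe] at h2
  have hv := v.coe_nonneg
  simp only [NNReal.coe_mul, Real.coe_toNNReal'] at h2
  norm_num at h2
  have : (v : ℝ) = 0 := by linarith
  exact_mod_cast this

lemma not_countable_set_nat : ¬Countable (Set ℕ) := fun _ =>
  let ⟨f, hf⟩ := Countable.exists_injective_nat (Set ℕ)
  Function.cantor_injective f hf

lemma not_countable_nat_to_bool : ¬Countable (ℕ → Bool) := by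
  classical
  intro h
  refine not_countable_set_nat (Function.Injective.countable
    (f := fun (S : Set ℕ) (n : ℕ) => decide (n ∈ S)) fun S T hST => ?_)
  ext n
  simpa using congrFun hST n

/-- Placing such a set among the exceptional points makes both exceptional sets uncountable standard
Borel spaces, hence isomorphic. An almost-everywhere bijection can then be completed to a bijection.
-/
lemma exists_null_not_countable : ∃ Z : Set I, MeasurableSet Z ∧ volume Z = 0 ∧ ¬Z.Countable := by
  have himg : (Subtype.val : I → ℝ) '' (Subtype.val ⁻¹' cantorSet) = cantorSet := by
    rw [Subtype.image_preimage_coe]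
    exact inter_eq_right.2 cantorSet_subset_unitInterval
  refine ⟨Subtype.val ⁻¹' cantorSet, measurable_subtype_coe isClosed_cantorSet.measurableSet, ?_,
    fun h => ?_⟩
  · rw [unitInterval.volume_apply, himg, volume_cantorSet]
  · have hc := h.image (Subtype.val : I → ℝ)
    rw [himg, ← countable_coe_iff, cantorSetEquivNatToBool.countable_iff] at hc
    exact not_countable_nat_to_bool hc

lemma exists_measurableEquiv_of_range_eq {α β γ : Type*} [MeasurableSpace α] [MeasurableSpace β]
    [MeasurableSpace γ] {f : α → γ} {f' : β → γ} (hf : MeasurableEmbedding f)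
    (hf' : MeasurableEmbedding f') (h : range f = range f') :
    ∃ e : β ≃ᵐ α, ∀ b, f (e b) = f' b := by
  rw [← image_univ, ← image_univ] at h
  have aux : ∀ J : Set γ, f '' univ = J → ∃ e : α ≃ᵐ J, ∀ a, (e a : γ) = f a := by
    rintro J rfl
    exact ⟨(MeasurableEquiv.Set.univ α).symm.trans (hf.equivImage univ), fun a => rfl⟩
  obtain ⟨e, he⟩ := aux _ h
  refine ⟨((MeasurableEquiv.Set.univ β).symm.trans (hf'.equivImage univ)).trans e.symm,
    fun b => ?_⟩
  rw [← he, MeasurableEquiv.trans_apply, MeasurableEquiv.apply_symm_apply]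
  rfl

/-- Two measurable maps on `[0,1]` with the same law that are injective off a null set differ by a
measure-preserving bijection. -/
lemma exists_measurePreserving_comp_eq {γ : Type*} [MeasurableSpace γ] [StandardBorelSpace γ]
    {Φ Φ' : I → γ} (hΦ : Measurable Φ) (hΦ' : Measurable Φ')
    (hmap : (volume : Measure I).map Φ = (volume : Measure I).map Φ') {G G' : Set I}
    (hG : MeasurableSet G) (hG' : MeasurableSet G') (hinj : InjOn Φ G) (hinj' : InjOn Φ' G')
    (hnull : ∀ᵐ t : I, t ∈ G) (hnull' : ∀ᵐ t : I, t ∈ G') :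
    ∃ τ : I ≃ᵐ I, MeasurePreserving τ volume volume ∧
      ∀ᵐ t : I, t ∈ G' ∧ τ t ∈ G ∧ Φ (τ t) = Φ' t := by
  classical
  obtain ⟨Z, hZ, hZ0, hZc⟩ := exists_null_not_countable
  have hZae : ∀ᵐ t : I, t ∉ Z := measure_eq_zero_iff_ae_notMem.1 hZ0
  -- `J` has full measure for the common law, and both maps are injective over it, so `Φ⁻¹ ∘ Φ'` is
  -- a Borel isomorphism from `A'` to `A`, two sets of full measure.
  set J : Set γ := Φ '' (G \ Z) ∩ Φ' '' (G' \ Z) with hJ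
  have him : MeasurableSet (Φ '' (G \ Z)) :=
    (hG.diff hZ).image_of_measurable_injOn hΦ (hinj.mono sdiff_subset)
  have him' : MeasurableSet (Φ' '' (G' \ Z)) :=
    (hG'.diff hZ).image_of_measurable_injOn hΦ' (hinj'.mono sdiff_subset)
  have hJm : MeasurableSet J := him.inter him'
  have hJae : ∀ᵐ p ∂((volume : Measure I).map Φ), p ∈ J := by
    have h1 : ∀ᵐ p ∂((volume : Measure I).map Φ), p ∈ Φ '' (G \ Z) := by
      refine (ae_map_iff (p := (· ∈ Φ '' (G \ Z))) hΦ.aemeasurable him).2 ?_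
      filter_upwards [hnull, hZae] with t h1 h2 using mem_image_of_mem _ ⟨h1, h2⟩
    have h2 : ∀ᵐ p ∂((volume : Measure I).map Φ), p ∈ Φ' '' (G' \ Z) := by
      rw [hmap]
      refine (ae_map_iff (p := (· ∈ Φ' '' (G' \ Z))) hΦ'.aemeasurable him').2 ?_
      filter_upwards [hnull', hZae] with t h1 h2 using mem_image_of_mem _ ⟨h1, h2⟩
    filter_upwards [h1, h2] with p h1 h2 using ⟨h1, h2⟩
  set A : Set I := (G \ Z) ∩ Φ ⁻¹' J with hA
  set A' : Set I := (G' \ Z) ∩ Φ' ⁻¹' J with hA'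
  have hAm : MeasurableSet A := (hG.diff hZ).inter (hΦ hJm)
  have hAm' : MeasurableSet A' := (hG'.diff hZ).inter (hΦ' hJm)
  have hAae : ∀ᵐ t : I, t ∈ A := by
    filter_upwards [hnull, hZae, ae_of_ae_map hΦ.aemeasurable hJae] with t h1 h2 h3
      using ⟨⟨h1, h2⟩, h3⟩
  have hAae' : ∀ᵐ t : I, t ∈ A' := by
    filter_upwards [hnull', hZae, ae_of_ae_map hΦ'.aemeasurable (hmap ▸ hJae)] with t h1 h2 h3
      using ⟨⟨h1, h2⟩, h3⟩
  have hAinj : InjOn Φ A := hinj.mono (inter_subset_left.trans sdiff_subset)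
  have hAinj' : InjOn Φ' A' := hinj'.mono (inter_subset_left.trans sdiff_subset)
  have hst : StandardBorelSpace A := hAm.standardBorel
  have hst' : StandardBorelSpace A' := hAm'.standardBorel
  obtain ⟨e, he⟩ : ∃ e : A' ≃ᵐ A, ∀ t, Φ (e t) = Φ' t := by
    refine exists_measurableEquiv_of_range_eq (f := fun t : A => Φ t) (f' := fun t : A' => Φ' t)
      ((hΦ.comp measurable_subtype_coe).measurableEmbedding (injOn_iff_injective.1 hAinj))
      ((hΦ'.comp measurable_subtype_coe).measurableEmbedding (injOn_iff_injective.1 hAinj')) ?_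
    have h1 : range (fun t : A => Φ t) = J := by
      rw [show (fun t : A => Φ t) = Φ ∘ Subtype.val from rfl, range_comp, Subtype.range_coe, hA,
        image_inter_preimage]
      exact inter_eq_right.2 inter_subset_left
    have h2 : range (fun t : A' => Φ' t) = J := by
      rw [show (fun t : A' => Φ' t) = Φ' ∘ Subtype.val from rfl, range_comp, Subtype.range_coe, hA',
        image_inter_preimage]
      exact inter_eq_right.2 inter_subset_right
    rw [h1, h2]
  have hcst : StandardBorelSpace (Aᶜ : Set I) := hAm.compl.standardBorel
  have hcst' : StandardBorelSpace (A'ᶜ : Set I) := hAm'.compl.standardBorel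
  have hunc : ¬Countable (Aᶜ : Set I) := fun h => hZc <|
    (countable_coe_iff.1 h).mono (subset_compl_comm.1 fun z hzA => hzA.1.2)
  have hunc' : ¬Countable (A'ᶜ : Set I) := fun h => hZc <|
    (countable_coe_iff.1 h).mono (subset_compl_comm.1 fun z hzA => hzA.1.2)
  let τ : I ≃ᵐ I := (MeasurableEquiv.sumCompl hAm').symm.trans
    ((MeasurableEquiv.sumCongr e (PolishSpace.measurableEquivOfNotCountable hunc' hunc)).trans
      (MeasurableEquiv.sumCompl hAm))
  have hτ : ∀ t (ht : t ∈ A'), τ t = e ⟨t, ht⟩ := by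
    intro t ht
    have h1 : (MeasurableEquiv.sumCompl hAm').symm t = Sum.inl ⟨t, ht⟩ :=
      (MeasurableEquiv.sumCompl hAm').symm_apply_eq.2 rfl
    simp only [τ, MeasurableEquiv.trans_apply, h1]
    rfl
  have hτA : ∀ t ∈ A', τ t ∈ A ∧ Φ (τ t) = Φ' t := by
    intro t ht
    rw [hτ t ht]
    exact ⟨(e ⟨t, ht⟩).2, he _⟩
  refine ⟨τ, ⟨τ.measurable, ?_⟩, ?_⟩
  · ext S hS
    rw [Measure.map_apply τ.measurable hS]
    have hSA : MeasurableSet (Φ '' (S ∩ A)) :=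
      (hS.inter hAm).image_of_measurable_injOn hΦ (hAinj.mono inter_subset_right)
    -- Up to null sets, `S` and `τ ⁻¹' S` are the preimages of one set under `Φ` and `Φ'`, whose
    -- laws agree.
    calc volume (τ ⁻¹' S) = volume (Φ' ⁻¹' (Φ '' (S ∩ A))) := by
          refine measure_congr ?_
          filter_upwards [hAae'] with t ht
          refine propext ⟨fun h => ⟨τ t, ⟨h, (hτA t ht).1⟩, (hτA t ht).2⟩, ?_⟩
          rintro ⟨s, ⟨hs, hsA⟩, hst⟩
          have : τ t = s := hAinj (hτA t ht).1 hsA ((hτA t ht).2.trans hst.symm)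
          rw [← this] at hs
          exact hs
      _ = volume (Φ ⁻¹' (Φ '' (S ∩ A))) := by
          rw [← Measure.map_apply hΦ' hSA, ← Measure.map_apply hΦ hSA, hmap]
      _ = volume S := by
          refine measure_congr ?_
          filter_upwards [hAae] with t ht
          refine propext ⟨?_, fun h => ⟨t, ⟨h, ht⟩, rfl⟩⟩
          rintro ⟨s, ⟨hs, hsA⟩, hst⟩
          exact hAinj hsA ht hst ▸ hs
  · filter_upwards [hAae'] with t ht using ⟨ht.1.1, (hτA t ht).1.1.1, (hτA t ht).2⟩

/-- The measure of the part of `E` to the left of `t`. -/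
def cumul (E : Set I) (t : I) : ℝ := (volume : Measure I).real (E ∩ Iic t)

lemma monotone_cumul (E : Set I) : Monotone (cumul E) := fun _ _ h =>
  measureReal_mono (inter_subset_inter_right _ (Iic_subset_Iic.2 h))

lemma cumul_le_add (E : Set I) {s t : I} (h : s ≤ t) : cumul E t ≤ cumul E s + (t - s : ℝ) := by
  have h1 : E ∩ Iic t ⊆ (E ∩ Iic s) ∪ Ioc s t := fun x hx => by
    rcases le_or_gt x s with hxs | hxs
    · exact Or.inl ⟨hx.1, hxs⟩
    · exact Or.inr ⟨hxs, hx.2⟩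
  refine (measureReal_mono h1).trans ((measureReal_union_le _ _).trans ?_)
  rw [measureReal_def (s := Ioc s t), unitInterval.volume_Ioc,
    ENNReal.toReal_ofReal (sub_nonneg.2 h), cumul]

lemma continuous_cumul (E : Set I) : Continuous (cumul E) := by
  refine (LipschitzWith.of_le_add_mul 1 fun s t => ?_).continuous
  rw [NNReal.coe_one, one_mul]
  rcases le_total s t with h | h
  · have := monotone_cumul E h
    linarith [dist_nonneg (x := s) (y := t)]
  · have := cumul_le_add E h
    rwa [Subtype.dist_eq, Real.dist_eq, abs_of_nonneg (sub_nonneg.2 (by exact_mod_cast h))]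

lemma cumul_one (E : Set I) : cumul E 1 = (volume : Measure I).real E := by
  rw [cumul, show Iic (1 : I) = univ from Iic_top, inter_univ]

lemma cumul_zero (E : Set I) : cumul E 0 = 0 := by
  rw [cumul, measureReal_def, measure_mono_null (t := {0}) _ (measure_singleton _)]
  · simp
  · rintro t ⟨-, ht⟩
    exact le_antisymm ht bot_le

/-- The function `cumul E` transports the measure on `E` to Lebesgue measure on an interval. -/
lemma map_cumul (E : Set I) :
    ((volume : Measure I).restrict E).map (cumul E) =
      (volume : Measure ℝ).restrict (Icc 0 ((volume : Measure I).real E)) := by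
  refine Measure.ext_of_Iic _ _ fun s => ?_
  have hc := continuous_cumul E
  rw [Measure.map_apply hc.measurable measurableSet_Iic, Measure.restrict_apply measurableSet_Iic,
    Measure.restrict_apply (hc.measurable measurableSet_Iic)]
  rcases lt_or_ge s 0 with hs | hs
  · have h1 : cumul E ⁻¹' Iic s ∩ E = ∅ := eq_empty_of_forall_notMem fun t ht =>
      (hs.trans_le measureReal_nonneg).not_ge ht.1
    have h2 : Iic s ∩ Icc 0 ((volume : Measure I).real E) = ∅ := eq_empty_of_forall_notMem fun t ht =>
      (hs.trans_le ht.2.1).not_ge ht.1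
    rw [h1, h2]
    simp
  rcases le_or_gt ((volume : Measure I).real E) s with hsE | hsE
  · have h1 : cumul E ⁻¹' Iic s ∩ E = E := inter_eq_right.2 fun t _ =>
      (measureReal_mono inter_subset_left).trans hsE
    rw [h1, inter_eq_right.2 (fun t ht => ht.2.trans hsE), Real.volume_Icc, sub_zero,
      ofReal_measureReal]
  · have h2 : Iic s ∩ Icc 0 ((volume : Measure I).real E) = Icc 0 s := by
      ext x
      simp only [mem_inter_iff, mem_Iic, mem_Icc]
      constructor
      · rintro ⟨h1, h2, h3⟩
        exact ⟨h2, h1⟩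
      · rintro ⟨h1, h3⟩
        exact ⟨h3, h1, h3.trans hsE.le⟩
    rw [h2, Real.volume_Icc, sub_zero]
    have hreal : ∀ t, volume (E ∩ Iic t) = ENNReal.ofReal (cumul E t) := fun t => by
      rw [cumul, ofReal_measureReal]
    refine le_antisymm ?_ ?_
    · have hcl : IsCompact (cumul E ⁻¹' Iic s) := (isClosed_Iic.preimage hc).isCompact
      obtain ⟨t, ht, htmax⟩ := hcl.exists_isGreatest ⟨0, by simpa [cumul_zero] using hs⟩
      refine (measure_mono (t := E ∩ Iic t) fun x hx => ⟨hx.2, htmax hx.1⟩).trans ?_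
      rw [hreal]
      exact ENNReal.ofReal_le_ofReal ht
    · obtain ⟨t, rfl⟩ : ∃ t, cumul E t = s := by
        refine mem_range_of_exists_le_of_exists_ge hc ⟨0, by rwa [cumul_zero]⟩ ⟨1, ?_⟩
        rw [cumul_one]
        exact hsE.le
      rw [← hreal]
      exact measure_mono fun x hx => ⟨monotone_cumul E hx.2, hx.1⟩

/-- The position of `t` in the level set of `U` it belongs to. -/
def levelPos (U : I → ℕ) (t : I) : ℝ := cumul (U ⁻¹' {U t}) t

lemma measurable_levelPos {U : I → ℕ} (hU : Measurable U) : Measurable (levelPos U) := by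
  have : Measurable (Function.uncurry fun (k : ℕ) (t : I) => cumul (U ⁻¹' {k}) t) :=
    measurable_from_prod_countable_right fun k => by
      simpa using (continuous_cumul _).measurable
  exact this.comp (hU.prodMk measurable_id)

lemma volume_level_inter_levelPos (U : I → ℕ) (k : ℕ) {S : Set ℝ}
    (hS : MeasurableSet S) : volume (U ⁻¹' {k} ∩ levelPos U ⁻¹' S) =
      volume (S ∩ Icc 0 ((volume : Measure I).real (U ⁻¹' {k}))) := by
  rw [← Measure.restrict_apply hS, ← map_cumul,
    Measure.map_apply (continuous_cumul _).measurable hS,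
    Measure.restrict_apply ((continuous_cumul _).measurable hS), inter_comm]
  congr 1
  ext t
  simp only [mem_inter_iff, mem_preimage, mem_singleton_iff, and_congr_left_iff]
  rintro rfl
  rfl

/-- By `map_cumul`, the position within a level is uniform on an interval whose length is the
measure of that level, so the measures of the levels determine the joint law. -/
lemma map_level_levelPos_eq {U U' : I → ℕ} (hU : Measurable U) (hU' : Measurable U')
    (h : ∀ k, volume (U ⁻¹' {k}) = volume (U' ⁻¹' {k})) :
    (volume : Measure I).map (fun t => (U t, levelPos U t)) =
      (volume : Measure I).map (fun t => (U' t, levelPos U' t)) := by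
  have key : ∀ {U : I → ℕ} (_ : Measurable U) {S : Set (ℕ × ℝ)} (_ : MeasurableSet S),
      (volume : Measure I).map (fun t => (U t, levelPos U t)) S =
        ∑' k, volume (Prod.mk k ⁻¹' S ∩ Icc 0 ((volume : Measure I).real (U ⁻¹' {k}))) := by
    intro U hU S hS
    have hm : Measurable fun t => (U t, levelPos U t) := hU.prodMk (measurable_levelPos hU)
    rw [Measure.map_apply hm hS]
    have : (fun t => (U t, levelPos U t)) ⁻¹' S =
        ⋃ k, (U ⁻¹' {k} ∩ levelPos U ⁻¹' (Prod.mk k ⁻¹' S)) := by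
      ext t
      simp
    rw [this, measure_iUnion]
    · exact tsum_congr fun k => volume_level_inter_levelPos U k (measurable_prodMk_left hS)
    · intro i j hij
      refine disjoint_left.2 fun t ht ht' => hij ?_
      exact ht.1.symm.trans ht'.1
    · exact fun k => (hU (measurableSet_singleton k)).inter
        (measurable_levelPos hU (measurable_prodMk_left hS))
  ext S hS
  rw [key hU hS, key hU' hS]
  simp only [measureReal_def, h]

/-- If two points of a level have equal position, `cumul` is constant between them, so their
position is a value at a point of a countable dense set. Only countably many positions are bad, and
these have measure zero. -/
lemma exists_injOn_level_levelPos {U : I → ℕ} (hU : Measurable U) :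
    ∃ G : Set I, MeasurableSet G ∧ (∀ᵐ t : I, t ∈ G) ∧ InjOn (fun t => (U t, levelPos U t)) G := by
  let D : Set I := TopologicalSpace.denseSeq I |> range
  let B : ℕ → Set ℝ := fun k => (cumul (U ⁻¹' {k})) '' D
  have hB : ∀ k, (B k).Countable := fun k => (countable_range _).image _
  have hbad : MeasurableSet (⋃ k, U ⁻¹' {k} ∩ levelPos U ⁻¹' (B k)) :=
    MeasurableSet.iUnion fun k => (hU (measurableSet_singleton k)).inter
      (measurable_levelPos hU (hB k).measurableSet)
  refine ⟨(⋃ k, U ⁻¹' {k} ∩ levelPos U ⁻¹' (B k))ᶜ, hbad.compl, ?_, ?_⟩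
  · refine measure_eq_zero_iff_ae_notMem.1 (measure_iUnion_null fun k => ?_)
    rw [volume_level_inter_levelPos U k (hB k).measurableSet]
    exact measure_mono_null inter_subset_left ((hB k).measure_zero _)
  · have key : ∀ s t : I, s < t → U s = U t → levelPos U s = levelPos U t →
        t ∈ ⋃ k, U ⁻¹' {k} ∩ levelPos U ⁻¹' (B k) := by
      intro s t hst hUst hpos
      obtain ⟨q, hqD, hsq, hqt⟩ :=
        (TopologicalSpace.denseRange_denseSeq I).exists_between hst
      refine mem_iUnion.2 ⟨U t, rfl, q, hqD, ?_⟩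
      rw [levelPos, hUst] at hpos
      exact le_antisymm (monotone_cumul _ hqt.le) (hpos ▸ monotone_cumul _ hsq.le)
    intro s hs t ht hst
    obtain ⟨h1, h2⟩ := Prod.mk.inj hst
    rcases lt_trichotomy s t with h | h | h
    · exact absurd (key s t h h1 h2) ht
    · exact h
    · exact absurd (key t s h h1.symm h2.symm) hs

/-- Two measurable maps `[0,1] → ℕ` with the same law differ by a measure-preserving bijection of
`[0,1]`, which moves almost no point of the common level sets. -/
theorem exists_measurePreserving_level {U U' : I → ℕ} (hU : Measurable U) (hU' : Measurable U')
    (h : ∀ k, volume (U ⁻¹' {k}) = volume (U' ⁻¹' {k})) :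
    ∃ τ : I ≃ᵐ I, MeasurePreserving τ volume volume ∧ (∀ᵐ t : I, U (τ t) = U' t) ∧
      ∀ k, U ⁻¹' {k} = U' ⁻¹' {k} → ∀ᵐ t : I, U' t = k → τ t = t := by
  obtain ⟨G, hG, hGae, hinj⟩ := exists_injOn_level_levelPos hU
  obtain ⟨G', hG', hGae', hinj'⟩ := exists_injOn_level_levelPos hU'
  obtain ⟨τ, hτ, hτae⟩ := exists_measurePreserving_comp_eq
    (hU.prodMk (measurable_levelPos hU)) (hU'.prodMk (measurable_levelPos hU'))
    (map_level_levelPos_eq hU hU' h) hG hG' hinj hinj' hGae hGae'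
  refine ⟨τ, hτ, ?_, fun k hk => ?_⟩
  · filter_upwards [hτae] with t ht using (Prod.mk.inj ht.2.2).1
  · filter_upwards [hτae, hGae] with t ht htG htk
    -- On a common level set both maps give the same position, so injectivity forces `τ t = t`.
    refine hinj ht.2.1 htG (ht.2.2.trans ?_)
    have hUt : U t = k := by
      have : t ∈ U ⁻¹' {k} := hk ▸ htk
      exact this
    simp only [levelPos, htk, hUt, hk]

end Transport

/-! ### Order continuity of the norm. -/

section OrderContinuity

open Filter Topology

variable {𝕜 : Type*} [RCLike 𝕜] {X : Type*} [NormedAddCommGroup X] [NormedSpace 𝕜 X]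
  {ι : X →ₗ[𝕜] (I →ₘ[(volume : Measure I)] 𝕜)}

lemma IsKotheFunctionSpace.norm_le_of_ae_le (hX : IsKotheFunctionSpace ι) {x y : X}
    (h : ∀ᵐ t : I, ‖ι x t‖ ≤ ‖ι y t‖) : ‖x‖ ≤ ‖y‖ := by
  obtain ⟨z, hz, hzy⟩ := hX.solid (ι x) y h
  rwa [hX.injective hz] at hzy

lemma IsKotheFunctionSpace.eq_of_ae_eq (hX : IsKotheFunctionSpace ι) {x y : X}
    (h : ι x =ᵐ[volume] ι y) : x = y :=
  hX.injective (AEEqFun.ext h)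

lemma measurable_coeFn (x : X) : Measurable (ι x : I → 𝕜) :=
  (AEEqFun.stronglyMeasurable _).measurable

lemma IsKotheFunctionSpace.exists_mul (hX : IsKotheFunctionSpace ι) (x : X) {w : I → 𝕜}
    (hw : Measurable w) (hw1 : ∀ t, ‖w t‖ ≤ 1) :
    ∃ y : X, (ι y =ᵐ[volume] fun t => w t * ι x t) ∧ ‖y‖ ≤ ‖x‖ := by
  have hm : AEStronglyMeasurable (fun t => w t * ι x t) (volume : Measure I) :=
    (hw.mul (measurable_coeFn x)).aestronglyMeasurable
  have hc := AEEqFun.coeFn_mk _ hm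
  obtain ⟨y, hy, hle⟩ := hX.solid (AEEqFun.mk _ hm) x (by
    filter_upwards [hc] with t ht
    rw [ht, norm_mul]
    exact mul_le_of_le_one_left (norm_nonneg _) (hw1 t))
  exact ⟨y, hy ▸ hc, hle⟩

lemma IsKotheFunctionSpace.exists_indicator (hX : IsKotheFunctionSpace ι) {A : Set I}
    (hA : MeasurableSet A) (x : X) : ∃ y : X, ι y =ᵐ[volume] A.indicator (ι x) := by
  obtain ⟨y, hy, -⟩ := hX.exists_mul x (w := A.indicator 1) (measurable_one.indicator hA)
    fun t => by by_cases h : t ∈ A <;> simp [h]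
  refine ⟨y, hy.trans (.of_forall fun t => ?_)⟩
  by_cases h : t ∈ A <;> simp [h]

/-- The element of `X` whose function is the function of `x`, restricted to `A`. -/
def cut (hX : IsKotheFunctionSpace ι) {A : Set I} (hA : MeasurableSet A) (x : X) : X :=
  (hX.exists_indicator hA x).choose

lemma coeFn_cut (hX : IsKotheFunctionSpace ι) {A : Set I} (hA : MeasurableSet A) (x : X) :
    ι (cut hX hA x) =ᵐ[volume] A.indicator (ι x) :=
  (hX.exists_indicator hA x).choose_spec

lemma norm_cut_le_of_subset (hX : IsKotheFunctionSpace ι) {A B : Set I} (hA : MeasurableSet A)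
    (hB : MeasurableSet B) (h : A ⊆ B) (x : X) : ‖cut hX hA x‖ ≤ ‖cut hX hB x‖ := by
  refine hX.norm_le_of_ae_le ?_
  filter_upwards [coeFn_cut hX hA x, coeFn_cut hX hB x] with t h1 h2
  rw [h1, h2]
  exact norm_indicator_le_of_subset h _ t

lemma cut_union (hX : IsKotheFunctionSpace ι) {A B : Set I} (hA : MeasurableSet A)
    (hB : MeasurableSet B) (h : Disjoint A B) (x : X) :
    cut hX (hA.union hB) x = cut hX hA x + cut hX hB x := by
  refine hX.eq_of_ae_eq ?_
  rw [map_add]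
  filter_upwards [coeFn_cut hX hA x, coeFn_cut hX hB x, coeFn_cut hX (hA.union hB) x,
    AEEqFun.coeFn_add (ι (cut hX hA x)) (ι (cut hX hB x))] with t h1 h2 h3 h4
  rw [h3, h4, Pi.add_apply, h1, h2, indicator_union_of_disjoint h]

lemma cut_univ (hX : IsKotheFunctionSpace ι) (x : X) : cut hX MeasurableSet.univ x = x :=
  hX.eq_of_ae_eq (by simpa using coeFn_cut hX MeasurableSet.univ x)

lemma cut_add_cut_compl (hX : IsKotheFunctionSpace ι) {A : Set I} (hA : MeasurableSet A) (x : X) :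
    cut hX hA x + cut hX hA.compl x = x := by
  rw [← cut_union hX hA hA.compl disjoint_compl_right x]
  conv_rhs => rw [← cut_univ hX x]
  congr 1
  simp

lemma cut_eq_zero (hX : IsKotheFunctionSpace ι) {A : Set I} (hA : MeasurableSet A)
    (h0 : volume A = 0) (x : X) : cut hX hA x = 0 := by
  refine hX.eq_of_ae_eq ?_
  rw [map_zero]
  filter_upwards [coeFn_cut hX hA x, measure_eq_zero_iff_ae_notMem.1 h0,
    AEEqFun.coeFn_zero (α := I) (β := 𝕜) (μ := volume)] with t h1 h2 h3
  rw [h1, h3, indicator_of_notMem h2, Pi.zero_apply]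

/-- A separable space has no uncountable separated family. -/
lemma exists_dist_lt_of_separable {Y : Type*} [PseudoMetricSpace Y]
    [TopologicalSpace.SeparableSpace Y] (f : Set ℕ → Y) {c : ℝ} (hc : 0 < c) :
    ∃ S T, S ≠ T ∧ dist (f S) (f T) < c := by
  by_contra! H
  have : Nonempty Y := ⟨f ∅⟩
  have h : ∀ S, ∃ n, dist (f S) (TopologicalSpace.denseSeq Y n) < c / 2 := fun S =>
    (TopologicalSpace.denseRange_denseSeq Y).exists_dist_lt (f S) (half_pos hc)
  choose n hn using h
  refine not_countable_set_nat (Function.Injective.countable (f := n) fun S T hST => ?_)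
  by_contra hne
  have h1 := hn S
  have h2 := hn T
  rw [← hST] at h2
  have := dist_triangle_right (f S) (f T) (TopologicalSpace.denseSeq Y (n S))
  linarith [H S T hne]

/-- An integral functional nearly norms `x` on `A n`. By dominated convergence its values on `A n \
A k` tend to that value, so a finite block already has large norm. -/
lemma exists_lt_norm_cut_diff (hX : IsKotheFunctionSpace ι) (hn : IsNorming (kotheDual ι)) (x : X)
    {A : ℕ → Set I} (hA : ∀ n, MeasurableSet (A n)) (hmono : Antitone A)
    (hnull : ∀ᵐ t : I, ∃ n, t ∉ A n) {c : ℝ} (n : ℕ) (hc : c < ‖cut hX (hA n) x‖) :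
    ∃ k, n < k ∧ c < ‖cut hX ((hA n).diff (hA k)) x‖ := by
  obtain ⟨r, ⟨φ, ⟨g, hg⟩, hφ, rfl⟩, hr, -⟩ := (hn (cut hX (hA n) x)).exists_between hc
  have hlim : Tendsto (fun k => φ (cut hX ((hA n).diff (hA k)) x)) atTop
      (𝓝 (φ (cut hX (hA n) x))) := by
    simp only [(hg _).2]
    refine tendsto_integral_of_dominated_convergence (fun t => ‖ι (cut hX (hA n) x) t * g t‖)
      (fun k => (hg _).1.aestronglyMeasurable) (hg _).1.norm (fun k => ?_) ?_
    · filter_upwards [coeFn_cut hX (hA n) x, coeFn_cut hX ((hA n).diff (hA k)) x] with t h1 h2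
      rw [norm_mul, norm_mul, h1, h2]
      gcongr
      exact norm_indicator_le_of_subset sdiff_subset _ t
    · have hall := ae_all_iff.2 fun k => coeFn_cut hX ((hA n).diff (hA k)) x
      filter_upwards [coeFn_cut hX (hA n) x, hall, hnull] with t h1 h2 h3
      obtain ⟨m, hm⟩ := h3
      refine tendsto_const_nhds.congr' ?_
      filter_upwards [eventually_ge_atTop m] with k hk
      have htk : t ∉ A k := fun h => hm (hmono hk h)
      rw [h1, h2]
      by_cases ht : t ∈ A n <;> simp [ht, htk]
  obtain ⟨k, hk, hnk⟩ := ((hlim.norm.eventually (lt_mem_nhds hr)).and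
    (eventually_gt_atTop n)).exists
  refine ⟨k, hnk, hk.trans_le ((φ.le_opNorm _).trans ?_)⟩
  exact mul_le_of_le_one_left (norm_nonneg _) hφ

/-- The norm of a separable Köthe function space with norming Köthe dual is order continuous. -/
theorem tendsto_norm_cut [TopologicalSpace.SeparableSpace X] (hX : IsKotheFunctionSpace ι)
    (hn : IsNorming (kotheDual ι)) (x : X) {A : ℕ → Set I} (hA : ∀ n, MeasurableSet (A n))
    (hmono : Antitone A) (hnull : ∀ᵐ t : I, ∃ n, t ∉ A n) :
    Tendsto (fun n => ‖cut hX (hA n) x‖) atTop (𝓝 0) := by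
  by_contra hnot
  obtain ⟨c, hc, hcA⟩ : ∃ c : ℝ, 0 < c ∧ ∀ n, c < ‖cut hX (hA n) x‖ := by
    rw [Metric.tendsto_atTop] at hnot
    push Not at hnot
    obtain ⟨c, hc, H⟩ := hnot
    refine ⟨c / 2, half_pos hc, fun n => ?_⟩
    obtain ⟨m, hm, hcm⟩ := H n
    rw [dist_zero_right, norm_norm] at hcm
    exact (half_lt_self hc).trans_le
      (hcm.trans (norm_cut_le_of_subset hX (hA m) (hA n) (hmono hm) x))
  choose k hk hck using fun n => exists_lt_norm_cut_diff hX hn x hA hmono hnull n (hcA n)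
  let N : ℕ → ℕ := fun i => k^[i] 0
  have hNs : ∀ i, N (i + 1) = k (N i) := fun i => Function.iterate_succ_apply' k i 0
  have hN : StrictMono N := strictMono_nat_of_lt_succ fun i => by rw [hNs]; exact hk _
  let D : ℕ → Set I := fun i => A (N i) \ A (k (N i))
  have hD : ∀ i, MeasurableSet (D i) := fun i => (hA _).diff (hA _)
  have hdisj : ∀ i j t, t ∈ D i → t ∈ D j → i = j := by
    have key : ∀ i j t, i < j → t ∈ D i → t ∉ D j := by
      intro i j t hij hi hj
      refine hi.2 (hmono ?_ hj.1)
      rw [← hNs]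
      exact hN.monotone hij
    intro i j t hi hj
    rcases lt_trichotomy i j with h | h | h
    · exact absurd hj (key i j t h hi)
    · exact h
    · exact absurd hi (key j i t h hj)
  have hU : ∀ S : Set ℕ, MeasurableSet (⋃ i ∈ S, D i) := fun S =>
    MeasurableSet.biUnion S.to_countable fun i _ => hD i
  -- The disjoint blocks `D i` all have norm above `c`. Two unions over different index sets differ
  -- by at least one whole block, which would give uncountably many `c`-separated vectors.
  obtain ⟨S, T, hST, hlt⟩ := exists_dist_lt_of_separable (fun S => cut hX (hU S) x) hc
  obtain ⟨i, hi⟩ : ∃ i, ¬(i ∈ S ↔ i ∈ T) := by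
    by_contra! H
    exact hST (Set.ext H)
  refine hlt.not_ge ((hck (N i)).le.trans ?_)
  rw [dist_eq_norm]
  refine hX.norm_le_of_ae_le ?_
  rw [map_sub]
  filter_upwards [coeFn_cut hX (hD i) x, coeFn_cut hX (hU S) x, coeFn_cut hX (hU T) x,
    AEEqFun.coeFn_sub (ι (cut hX (hU S) x)) (ι (cut hX (hU T) x))] with t h1 h2 h3 h4
  rw [h4, Pi.sub_apply, h2, h3, h1]
  by_cases ht : t ∈ D i
  · have hmem : ∀ R : Set ℕ, t ∈ ⋃ j ∈ R, D j ↔ i ∈ R := by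
      intro R
      simp only [mem_iUnion, exists_prop]
      exact ⟨fun ⟨j, hj, htj⟩ => hdisj i j t ht htj ▸ hj, fun h => ⟨i, h, ht⟩⟩
    by_cases hiS : i ∈ S <;> by_cases hiT : i ∈ T <;> simp_all [indicator]
  · rw [indicator_of_notMem ht, norm_zero]
    exact norm_nonneg _

end OrderContinuity

/-! ### Integral representation of functionals. -/

section Representation

open Filter Topology

variable {𝕜 : Type*} [RCLike 𝕜] {X : Type*} [NormedAddCommGroup X] [NormedSpace 𝕜 X]
  {ι : X →ₗ[𝕜] (I →ₘ[(volume : Measure I)] 𝕜)}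

lemma apply_cut_iUnion_eq (hX : IsKotheFunctionSpace ι) (x : X) (L : X →+ ℝ) {f : ℕ → Set I}
    (hf : ∀ i, MeasurableSet (f i)) (hd : Pairwise (Function.onFun Disjoint f)) (s : Finset ℕ) :
    L (cut hX (MeasurableSet.iUnion hf) x) = ∑ i ∈ s, L (cut hX (hf i) x) +
      L (cut hX (MeasurableSet.biUnion (to_countable {i | i ∉ s}) fun i _ => hf i) x) := by
  classical
  induction s using Finset.induction_on with
  | empty =>
    rw [Finset.sum_empty, zero_add]
    congr 2
    simp
  | insert a s ha ih =>
    rw [ih, Finset.sum_insert ha, add_comm (L _) (∑ i ∈ s, _), add_assoc]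
    congr 1
    have hm := MeasurableSet.biUnion (to_countable {i | i ∉ insert a s}) fun i _ => hf i
    have hdisj : Disjoint (f a) (⋃ i ∈ {i | i ∉ insert a s}, f i) := by
      refine disjoint_iUnion₂_right.2 fun i hi => hd fun h => hi ?_
      simp [h]
    rw [← map_add, ← cut_union hX (hf a) hm hdisj]
    congr 2
    ext t
    simp only [mem_iUnion, mem_union, exists_prop, mem_ofPred_eq, Finset.mem_insert, not_or]
    constructor
    · rintro ⟨i, hi, hti⟩
      rcases eq_or_ne i a with rfl | hia
      · exact Or.inl hti
      · exact Or.inr ⟨i, ⟨hia, hi⟩, hti⟩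
    · rintro (hta | ⟨i, hi, hti⟩)
      · exact ⟨a, ha, hta⟩
      · exact ⟨i, hi.2, hti⟩

lemma hasSum_apply_cut [TopologicalSpace.SeparableSpace X]
    (hX : IsKotheFunctionSpace ι) (hn : IsNorming (kotheDual ι)) (x : X)
    (L : X →+ ℝ) {C : ℝ} (hL : ∀ x, |L x| ≤ C * ‖x‖) {f : ℕ → Set I}
    (hf : ∀ i, MeasurableSet (f i)) (hd : Pairwise (Function.onFun Disjoint f)) :
    HasSum (fun i => L (cut hX (hf i) x)) (L (cut hX (MeasurableSet.iUnion hf) x)) := by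
  -- A negative `C` is compatible with the bound `hL` only when the norm vanishes.
  have hC : 0 ≤ C ∨ ‖x‖ = 0 := by
    by_contra! h
    have := (abs_nonneg _).trans (hL x)
    have hx : 0 < ‖x‖ := lt_of_le_of_ne (norm_nonneg x) h.2.symm
    nlinarith
  have hA : ∀ n, MeasurableSet (⋃ i ∈ {i | n ≤ i}, f i) := fun n =>
    MeasurableSet.biUnion (to_countable _) fun i _ => hf i
  have hlim := (tendsto_norm_cut hX hn x hA (fun m n hmn => biUnion_subset_biUnion_left
    fun i (hi : n ≤ i) => hmn.trans hi) (.of_forall fun t => ?_)).const_mul C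
  · rw [mul_zero] at hlim
    rw [HasSum, SummationFilter.unconditional_filter, Metric.tendsto_atTop]
    intro ε hε
    obtain ⟨n, hnε⟩ := (hlim.eventually (gt_mem_nhds hε)).exists
    refine ⟨Finset.range n, fun s hs => ?_⟩
    rw [apply_cut_iUnion_eq hX x L hf hd s, dist_comm, Real.dist_eq, add_sub_cancel_left]
    refine (hL _).trans_lt (lt_of_le_of_lt ?_ hnε)
    have hle : ‖cut hX (MeasurableSet.biUnion (to_countable {i | i ∉ s}) fun i _ => hf i) x‖ ≤
        ‖cut hX (hA n) x‖ := by
      refine norm_cut_le_of_subset hX _ _ (biUnion_subset_biUnion_left fun i hi => ?_) x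
      by_contra hin
      exact hi (hs (Finset.mem_range.2 (not_le.1 hin)))
    rcases hC with hC | hx0
    · exact mul_le_mul_of_nonneg_left hle hC
    · have hz : ∀ {B : Set I} (hB : MeasurableSet B), ‖cut hX hB x‖ = 0 := fun hB =>
        le_antisymm ((norm_cut_le_of_subset hX hB MeasurableSet.univ (subset_univ _) x).trans
          (by rw [cut_univ, hx0])) (norm_nonneg _)
      rw [hz, hz]
  · by_contra! h
    obtain ⟨i, hi, hti⟩ := mem_iUnion₂.1 (h 0)
    obtain ⟨j, hj, htj⟩ := mem_iUnion₂.1 (h (i + 1))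
    have hij : i ≠ j := fun h => by
      have hj' : i + 1 ≤ j := hj
      omega
    exact disjoint_left.1 (hd hij) hti htj

/-- Order continuity makes `A ↦ L(x 1_A)` countably additive, and it vanishes on null sets, so
Radon–Nikodym applies. -/
lemma exists_density_real [TopologicalSpace.SeparableSpace X]
    (hX : IsKotheFunctionSpace ι) (hn : IsNorming (kotheDual ι)) (x : X)
    (L : X →+ ℝ) {C : ℝ} (hL : ∀ x, |L x| ≤ C * ‖x‖) :
    ∃ r : I → ℝ, Measurable r ∧ Integrable r volume ∧
      ∀ (A : Set I) (hA : MeasurableSet A), L (cut hX hA x) = ∫ t in A, r t := by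
  classical
  let ν : SignedMeasure I :=
    { measureOf' := fun A => if hA : MeasurableSet A then L (cut hX hA x) else 0
      empty' := by
        rw [dif_pos MeasurableSet.empty, cut_eq_zero hX _ measure_empty, map_zero]
      not_measurable' := fun A hA => dif_neg hA
      m_iUnion' := fun f hf hd => by
        simp only [hf, dif_pos, MeasurableSet.iUnion hf]
        exact hasSum_apply_cut hX hn x L hL hf hd }
  have hν : ∀ A (hA : MeasurableSet A), ν A = L (cut hX hA x) := fun A hA => dif_pos hA
  have hac : ν ≪ᵥ (volume : Measure I).toENNRealVectorMeasure := by
    refine VectorMeasure.AbsolutelyContinuous.mk fun A hA h0 => ?_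
    rw [Measure.toENNRealVectorMeasure_apply_measurable hA] at h0
    rw [hν A hA, cut_eq_zero hX hA h0, map_zero]
  refine ⟨ν.rnDeriv volume, SignedMeasure.measurable_rnDeriv _ _,
    SignedMeasure.integrable_rnDeriv _ _, fun A hA => ?_⟩
  rw [← withDensityᵥ_apply (SignedMeasure.integrable_rnDeriv _ _) hA,
    SignedMeasure.withDensityᵥ_rnDeriv_eq _ _ hac, hν A hA]

lemma exists_density_indicator [TopologicalSpace.SeparableSpace X]
    (hX : IsKotheFunctionSpace ι) (hn : IsNorming (kotheDual ι))
    (x : X) (φ : StrongDual 𝕜 X) :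
    ∃ g : I → 𝕜, Measurable g ∧ Integrable g volume ∧
      ∀ (A : Set I) (hA : MeasurableSet A), φ (cut hX hA x) = ∫ t in A, g t := by
  obtain ⟨r, hr, hri, hrA⟩ := exists_density_real hX hn x
    ((RCLike.re : 𝕜 →+ ℝ).comp (φ : X →+ 𝕜)) (C := ‖φ‖)
    fun x => (RCLike.abs_re_le_norm _).trans (φ.le_opNorm x)
  obtain ⟨s, hs, hsi, hsA⟩ := exists_density_real hX hn x
    ((RCLike.im : 𝕜 →+ ℝ).comp (φ : X →+ 𝕜)) (C := ‖φ‖)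
    fun x => (RCLike.abs_im_le_norm _).trans (φ.le_opNorm x)
  have hri' : Integrable (fun t => (r t : 𝕜)) volume := hri.ofReal
  have hsi' : Integrable (fun t => (s t : 𝕜) * RCLike.I) volume := hsi.ofReal.mul_const _
  refine ⟨fun t => r t + s t * RCLike.I, by fun_prop, hri'.add hsi', fun A hA => ?_⟩
  rw [integral_add hri'.integrableOn hsi'.integrableOn, integral_mul_const, integral_ofReal,
    integral_ofReal, ← hrA A hA, ← hsA A hA]
  exact (RCLike.re_add_im _).symm

lemma exists_simpleFunc_dist_le {f : I → 𝕜} (hf : Measurable f) {C : ℝ} (hC : ∀ t, ‖f t‖ ≤ C)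
    {δ : ℝ} (hδ : 0 < δ) : ∃ s : SimpleFunc I 𝕜, ∀ t, ‖f t - s t‖ ≤ δ := by
  let e : ℕ → 𝕜 := TopologicalSpace.denseSeq 𝕜
  obtain ⟨F, hF⟩ := (isCompact_closedBall (0 : 𝕜) C).elim_finite_subcover
    (fun n => Metric.ball (e n) δ) (fun n => Metric.isOpen_ball) fun z _ => by
      obtain ⟨n, hn⟩ := (TopologicalSpace.denseRange_denseSeq 𝕜).exists_dist_lt z hδ
      exact mem_iUnion.2 ⟨n, hn⟩
  refine ⟨(SimpleFunc.nearestPt e (F.sup id)).comp f hf, fun t => ?_⟩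
  obtain ⟨n, hnF, hn⟩ := mem_iUnion₂.1 (hF (mem_closedBall_zero_iff.2 (hC t)))
  have h := SimpleFunc.edist_nearestPt_le e (f t) (Finset.le_sup (f := id) hnF)
  rw [id, edist_dist, edist_dist, ENNReal.ofReal_le_ofReal_iff dist_nonneg] at h
  rw [SimpleFunc.coe_comp, Function.comp_apply, ← dist_eq_norm, dist_comm]
  exact h.trans (by rw [dist_comm]; exact (Metric.mem_ball.1 hn).le)

lemma IsRearrangementInvariant.exists_of_bounded (hX : IsRearrangementInvariant ι) {f : I → 𝕜}
    (hf : Measurable f) {C : ℝ} (hC : ∀ t, ‖f t‖ ≤ C) :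
    ∃ x : X, ι x =ᵐ[volume] f ∧ ‖x‖ ≤ C := by
  have hC0 : 0 ≤ C := (norm_nonneg _).trans (hC 0)
  have hm := hf.aestronglyMeasurable (μ := (volume : Measure I))
  have hc := AEEqFun.coeFn_mk f hm
  have hbd : ∀ᵐ t : I, ‖AEEqFun.mk f hm t‖ ≤ C := by
    filter_upwards [hc] with t ht using ht ▸ hC t
  obtain ⟨x, hx, hxn⟩ := hX.linfty_le (AEEqFun.mk f hm)
    (memLp_top_of_bound (AEEqFun.aestronglyMeasurable _) C hbd)
  refine ⟨x, hx ▸ hc, ?_⟩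
  have h2 : ‖x‖ₑ ≤ ENNReal.ofReal C := hxn.trans (by
    rw [eLpNorm_exponent_top]
    exact eLpNormEssSup_le_of_ae_bound hbd)
  rwa [← ofReal_norm, ENNReal.ofReal_le_ofReal_iff hC0] at h2

lemma IsRearrangementInvariant.norm_le_of_bounded (hX : IsRearrangementInvariant ι) {x : X} {C : ℝ}
    (hC0 : 0 ≤ C) (hC : ∀ᵐ t : I, ‖ι x t‖ ≤ C) : ‖x‖ ≤ C := by
  obtain ⟨y, hy, hyn⟩ := hX.exists_of_bounded (f := fun _ => (C : 𝕜)) measurable_const (C := C)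
    fun _ => by simp [abs_of_nonneg hC0]
  refine (hX.norm_le_of_ae_le ?_).trans hyn
  filter_upwards [hC, hy] with t h1 h2
  rw [h2]
  simpa [abs_of_nonneg hC0] using h1

lemma apply_eq_integral_of_simple (hX : IsRearrangementInvariant ι) {φ : StrongDual 𝕜 X}
    {g : I → 𝕜} {u : X} (hg : Integrable g volume) (hu : ι u =ᵐ[volume] fun _ => 1)
    (h : ∀ (A : Set I) (hA : MeasurableSet A), φ (cut hX.toIsKotheFunctionSpace hA u) =
      ∫ t in A, g t) (s : SimpleFunc I 𝕜) :
    ∀ x : X, ι x =ᵐ[volume] s → φ x = ∫ t, s t * g t := by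
  induction s using SimpleFunc.induction with
  | const c hA =>
    rename_i A
    intro x hx
    have hxu : x = c • cut hX.toIsKotheFunctionSpace hA u := by
      refine hX.eq_of_ae_eq ?_
      rw [map_smul]
      filter_upwards [hx, hu, coeFn_cut hX.toIsKotheFunctionSpace hA u,
        AEEqFun.coeFn_smul c (ι (cut hX.toIsKotheFunctionSpace hA u))] with t h1 h2 h3 h4
      rw [h1, h4, Pi.smul_apply, h3]
      by_cases ht : t ∈ A <;> simp [ht, h2]
    rw [hxu, map_smul, h A hA, smul_eq_mul, ← integral_const_mul, ← integral_indicator hA]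
    refine integral_congr_ae (.of_forall fun t => ?_)
    by_cases ht : t ∈ A <;> simp [ht]
  | @add f₁ f₂ _ h₁ h₂ =>
    intro x hx
    have hb : ∀ f : SimpleFunc I 𝕜, ∃ C, ∀ t, ‖f t‖ ≤ C := fun f => by
      obtain ⟨C, hC⟩ := f.exists_forall_norm_le
      exact ⟨C, hC⟩
    obtain ⟨C₁, hC₁⟩ := hb f₁
    obtain ⟨C₂, hC₂⟩ := hb f₂
    obtain ⟨y₁, hy₁, -⟩ := hX.exists_of_bounded f₁.measurable hC₁
    obtain ⟨y₂, hy₂, -⟩ := hX.exists_of_bounded f₂.measurable hC₂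
    have hxy : x = y₁ + y₂ := by
      refine hX.eq_of_ae_eq ?_
      rw [map_add]
      filter_upwards [hx, hy₁, hy₂, AEEqFun.coeFn_add (ι y₁) (ι y₂)] with t e1 e2 e3 e4
      rw [e1, e4, Pi.add_apply, e2, e3, SimpleFunc.coe_add, Pi.add_apply]
    rw [hxy, map_add, h₁ y₁ hy₁, h₂ y₂ hy₂, ← integral_add]
    · simp [add_mul]
    · exact hg.bdd_mul f₁.measurable.aestronglyMeasurable (.of_forall hC₁)
    · exact hg.bdd_mul f₂.measurable.aestronglyMeasurable (.of_forall hC₂)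

lemma apply_eq_integral_of_bounded (hX : IsRearrangementInvariant ι) {φ : StrongDual 𝕜 X}
    {g : I → 𝕜} {u : X} (hg : Integrable g volume) (hu : ι u =ᵐ[volume] fun _ => 1)
    (h : ∀ (A : Set I) (hA : MeasurableSet A), φ (cut hX.toIsKotheFunctionSpace hA u) =
      ∫ t in A, g t) {x : X} {C : ℝ} (hC : ∀ᵐ t : I, ‖ι x t‖ ≤ C) :
    φ x = ∫ t, ι x t * g t := by
  let f : I → 𝕜 := {t | ‖ι x t‖ ≤ C}.indicator (ι x)
  have hm := measurable_coeFn (ι := ι) x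
  have hf : Measurable f := hm.indicator (measurableSet_le hm.norm measurable_const)
  have hxf : ι x =ᵐ[volume] f := by
    filter_upwards [hC] with t ht
    exact (indicator_of_mem (s := {t | ‖ι x t‖ ≤ C}) ht (ι x)).symm
  have hfC : ∀ t, ‖f t‖ ≤ |C| := fun t => by
    by_cases ht : t ∈ {t | ‖ι x t‖ ≤ C}
    · simp only [f, indicator_of_mem ht]
      exact le_trans ht (le_abs_self C)
    · simp only [f, indicator_of_notMem ht, norm_zero, abs_nonneg]
  have hfg : Integrable (fun t => f t * g t) volume :=
    hg.bdd_mul hf.aestronglyMeasurable (.of_forall hfC)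
  rw [integral_congr_ae (g := fun t => f t * g t) (by
    filter_upwards [hxf] with t ht using by rw [ht])]
  rw [← sub_eq_zero, ← norm_le_zero_iff]
  refine le_of_forall_pos_le_add fun ε hε => ?_
  set M : ℝ := ‖φ‖ + ∫ t, ‖g t‖ with hM
  have hg0 : 0 ≤ ∫ t, ‖g t‖ := integral_nonneg fun _ => norm_nonneg _
  have hM0 : 0 ≤ M := add_nonneg (norm_nonneg _) hg0
  -- A uniform error `δ` costs at most `δ * ‖φ‖` in `φ` and `δ * ∫ ‖g‖` in the integral, hence `δ *
  -- M` in all; the `+ 1` avoids division by zero.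
  obtain ⟨s, hs⟩ := exists_simpleFunc_dist_le hf hfC (δ := ε / (M + 1)) (by positivity)
  set δ := ε / (M + 1) with hδ
  have hδ0 : 0 ≤ δ := by positivity
  have hsC : ∀ t, ‖s t‖ ≤ |C| + δ := fun t => by
    have := norm_sub_norm_le (s t) (f t)
    rw [norm_sub_rev] at this
    linarith [hs t, hfC t]
  obtain ⟨y, hy, -⟩ := hX.exists_of_bounded s.measurable hsC
  have hsg : Integrable (fun t => s t * g t) volume :=
    hg.bdd_mul s.measurable.aestronglyMeasurable (.of_forall hsC)
  have h1 : ‖x - y‖ ≤ δ := by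
    refine hX.norm_le_of_bounded hδ0 ?_
    rw [map_sub]
    filter_upwards [hxf, hy, AEEqFun.coeFn_sub (ι x) (ι y)] with t e1 e2 e3
    rw [e3, Pi.sub_apply, e1, e2]
    exact hs t
  have h2 : ‖∫ t, (s t * g t - f t * g t)‖ ≤ δ * ∫ t, ‖g t‖ := by
    rw [← integral_const_mul]
    refine norm_integral_le_of_norm_le (hg.norm.const_mul δ) (.of_forall fun t => ?_)
    rw [← sub_mul, norm_mul, norm_sub_rev]
    gcongr
    exact hs t
  have h3 : φ x - ∫ t, f t * g t = φ (x - y) + ∫ t, (s t * g t - f t * g t) := by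
    rw [map_sub, apply_eq_integral_of_simple hX hg hu h s y hy, integral_sub hsg hfg]
    ring
  rw [h3, zero_add]
  refine (norm_add_le _ _).trans ?_
  have h4 := (φ.le_opNorm (x - y)).trans (mul_le_mul_of_nonneg_left h1 (norm_nonneg φ))
  have h5 : δ * (M + 1) = ε := by rw [hδ]; field_simp
  nlinarith

/-- The phase of the complex conjugate. -/
def phase (z : 𝕜) : 𝕜 := (starRingEnd 𝕜) z / (‖z‖ : 𝕜)

lemma norm_phase_le (z : 𝕜) : ‖phase z‖ ≤ 1 := by
  rw [phase, norm_div, RCLike.norm_conj, RCLike.norm_ofReal, abs_norm]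
  exact div_self_le_one _

lemma phase_mul_self (z : 𝕜) : phase z * z = (‖z‖ : 𝕜) := by
  rcases eq_or_ne z 0 with rfl | hz
  · simp [phase]
  · have h : (‖z‖ : 𝕜) ≠ 0 := by simpa using hz
    rw [phase, div_mul_eq_mul_div, RCLike.conj_mul, sq, mul_div_assoc, div_self h, mul_one]

lemma measurable_phase : Measurable (phase : 𝕜 → 𝕜) := by
  unfold phase
  exact (RCLike.continuous_conj.measurable).div (RCLike.measurable_ofReal.comp measurable_norm)

/-- Solidity permits multiplying `x` by the phase that turns `x G` into `|x G|`; the value of `φ`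
there is the integral of the modulus. -/
lemma lintegral_le_of_forall_apply_eq (hX : IsKotheFunctionSpace ι) (φ : StrongDual 𝕜 X)
    {G : I → 𝕜} (hG : Measurable G) (x : X) (hi : Integrable (fun t => ι x t * G t) volume)
    (h : ∀ y : X, (∀ᵐ t : I, ‖ι y t‖ ≤ ‖ι x t‖) → φ y = ∫ t, ι y t * G t) :
    ∫⁻ t, ‖ι x t‖ₑ * ‖G t‖ₑ ≤ ‖φ‖ₑ * ‖x‖ₑ := by
  obtain ⟨y, hy, hyx⟩ := hX.exists_mul x (w := fun t => phase (ι x t * G t))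
    (measurable_phase.comp ((measurable_coeFn x).mul hG)) fun t => norm_phase_le _
  have h1 : φ y = ((∫ t, ‖ι x t * G t‖ : ℝ) : 𝕜) := by
    rw [h y, ← integral_ofReal]
    · refine integral_congr_ae ?_
      filter_upwards [hy] with t ht
      rw [ht, mul_assoc, phase_mul_self]
    · filter_upwards [hy] with t ht
      rw [ht, norm_mul]
      exact mul_le_of_le_one_left (norm_nonneg _) (norm_phase_le _)
  have h2 : ∫ t, ‖ι x t * G t‖ ≤ ‖φ‖ * ‖x‖ := by
    have := (φ.le_opNorm y).trans (mul_le_mul_of_nonneg_left hyx (norm_nonneg φ))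
    rwa [h1, RCLike.norm_ofReal, abs_of_nonneg (integral_nonneg fun _ => norm_nonneg _)] at this
  simp_rw [← enorm_mul]
  rw [← ofReal_integral_norm_eq_lintegral_enorm hi, ← ofReal_norm φ,
    ← ofReal_norm x, ← ENNReal.ofReal_mul (norm_nonneg _)]
  exact ENNReal.ofReal_le_ofReal h2

lemma exists_functional_of_lintegral_le {G : I → 𝕜} (hG : Measurable G)
    (h : ∀ x : X, ∫⁻ t, ‖ι x t‖ₑ * ‖G t‖ₑ ≤ ‖x‖ₑ) :
    ∃ φ : StrongDual 𝕜 X, ‖φ‖ ≤ 1 ∧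
      ∀ x, Integrable (fun t => ι x t * G t) volume ∧ φ x = ∫ t, ι x t * G t := by
  have hi : ∀ x : X, Integrable (fun t => ι x t * G t) volume := fun x => by
    refine ⟨((measurable_coeFn x).mul hG).aestronglyMeasurable, ?_⟩
    rw [HasFiniteIntegral]
    simp_rw [enorm_mul]
    exact (h x).trans_lt enorm_lt_top
  let L : X →ₗ[𝕜] 𝕜 :=
    { toFun := fun x => ∫ t, ι x t * G t
      map_add' := fun x y => by
        rw [← integral_add (hi x) (hi y)]
        refine integral_congr_ae ?_
        rw [map_add]
        filter_upwards [AEEqFun.coeFn_add (ι x) (ι y)] with t ht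
        rw [ht, Pi.add_apply, add_mul]
      map_smul' := fun c x => by
        rw [RingHom.id_apply, smul_eq_mul, ← integral_const_mul]
        refine integral_congr_ae ?_
        rw [map_smul]
        filter_upwards [AEEqFun.coeFn_smul c (ι x)] with t ht
        rw [ht, Pi.smul_apply, smul_eq_mul, mul_assoc] }
  refine ⟨L.mkContinuous 1 fun x => ?_, L.mkContinuous_norm_le zero_le_one _, fun x => ⟨hi x, rfl⟩⟩
  rw [one_mul]
  refine (norm_integral_le_integral_norm _).trans ?_
  have h1 := h x
  simp_rw [← enorm_mul] at h1
  rwa [← ofReal_integral_norm_eq_lintegral_enorm (hi x), ← ofReal_norm x,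
    ENNReal.ofReal_le_ofReal_iff (norm_nonneg _)] at h1

/-- Every functional on a separable r.i. space is an integral. -/
theorem exists_density [TopologicalSpace.SeparableSpace X] (hX : IsRearrangementInvariant ι)
    (φ : StrongDual 𝕜 X) : ∃ g : I → 𝕜, Measurable g ∧
      ∀ x, Integrable (fun t => ι x t * g t) volume ∧ φ x = ∫ t, ι x t * g t := by
  have hK := hX.toIsKotheFunctionSpace
  obtain ⟨u, hu, -⟩ := hX.exists_of_bounded (f := fun _ => (1 : 𝕜)) measurable_const (C := 1)
    fun _ => by simp
  obtain ⟨g, hg, hgi, hgA⟩ := exists_density_indicator hK hX.norming u φ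
  have hbdd : ∀ (x : X) (C : ℝ), (∀ᵐ t : I, ‖ι x t‖ ≤ C) → φ x = ∫ t, ι x t * g t :=
    fun x C hC => apply_eq_integral_of_bounded hX hgi hu hgA hC
  refine ⟨g, hg, fun x => ?_⟩
  have hm := measurable_coeFn (ι := ι) x
  -- Truncate `x` off `A n`. The bound on the truncations and monotone convergence make `x g`
  -- integrable; dominated convergence on one side and order continuity on the other identify the
  -- limit.
  let A : ℕ → Set I := fun n => {t | (n : ℝ) < ‖ι x t‖}
  have hA : ∀ n, MeasurableSet (A n) := fun n => measurableSet_lt measurable_const hm.norm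
  have hAt : ∀ t, ∀ᶠ n in atTop, t ∉ A n := fun t => by
    filter_upwards [eventually_ge_atTop ⌈‖ι x t‖⌉₊] with n hn h
    exact (not_lt.2 (Nat.ceil_le.1 hn)) h
  have hanti : Antitone A := fun m n hmn t (ht : (n : ℝ) < _) =>
    lt_of_le_of_lt (by exact_mod_cast hmn) ht
  let y : ℕ → X := fun n => cut hK (hA n).compl x
  have hy : ∀ n, ι (y n) =ᵐ[volume] (A n)ᶜ.indicator (ι x) := fun n => coeFn_cut hK (hA n).compl x
  have hyall := ae_all_iff.2 hy
  have hybd : ∀ n, ∀ᵐ t : I, ‖ι (y n) t‖ ≤ n := fun n => by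
    filter_upwards [hy n] with t ht
    rw [ht]
    by_cases h : t ∈ A n
    · simp [h]
    · simpa [h] using not_lt.1 h
  have hyle : ∀ n, ∀ᵐ t : I, ‖ι (y n) t‖ ≤ ‖ι x t‖ := fun n => by
    filter_upwards [hy n] with t ht
    rw [ht]
    exact norm_indicator_le_norm_self _ _
  have hev : ∀ᵐ t : I, ∀ᶠ n in atTop, ι (y n) t = ι x t := by
    filter_upwards [hyall] with t ht
    filter_upwards [hAt t] with n hn
    rw [ht n, indicator_of_mem (show t ∈ (A n)ᶜ from hn)]
  have hyi : ∀ n, Integrable (fun t => ι (y n) t * g t) volume := fun n =>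
    hgi.bdd_mul (measurable_coeFn _).aestronglyMeasurable (hybd n)
  have hyl : ∀ n, ∫⁻ t, ‖ι (y n) t‖ₑ * ‖g t‖ₑ ≤ ‖φ‖ₑ * ‖x‖ₑ := fun n => by
    refine (lintegral_le_of_forall_apply_eq hK φ hg (y n) (hyi n) fun z hz => ?_).trans ?_
    · refine hbdd z n ?_
      filter_upwards [hz, hybd n] with t h1 h2 using h1.trans h2
    · gcongr
      rw [enorm_le_iff_norm_le]
      exact hK.norm_le_of_ae_le (hyle n)
  have hlim : Tendsto (fun n => ∫⁻ t, ‖ι (y n) t‖ₑ * ‖g t‖ₑ) atTop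
      (𝓝 (∫⁻ t, ‖ι x t‖ₑ * ‖g t‖ₑ)) := by
    refine lintegral_tendsto_of_tendsto_of_monotone
      (fun n => ((measurable_coeFn _).enorm.mul hg.enorm).aemeasurable) ?_ ?_
    · filter_upwards [hyall] with t ht m n hmn
      dsimp only
      rw [ht m, ht n]
      gcongr
      exact enorm_indicator_le_of_subset (compl_subset_compl.2 (hanti hmn)) _ t
    · filter_upwards [hev] with t ht
      refine tendsto_const_nhds.congr' ?_
      filter_upwards [ht] with n hn
      rw [hn]
  have hxi : Integrable (fun t => ι x t * g t) volume := by
    refine ⟨(hm.mul hg).aestronglyMeasurable, ?_⟩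
    rw [HasFiniteIntegral]
    simp_rw [enorm_mul]
    exact (le_of_tendsto' hlim hyl).trans_lt (ENNReal.mul_lt_top enorm_lt_top enorm_lt_top)
  refine ⟨hxi, ?_⟩
  have h1 : Tendsto (fun n => φ (y n)) atTop (𝓝 (∫ t, ι x t * g t)) := by
    simp_rw [fun n => hbdd (y n) n (hybd n)]
    refine tendsto_integral_of_dominated_convergence (fun t => ‖ι x t * g t‖)
      (fun n => (hyi n).aestronglyMeasurable) hxi.norm (fun n => ?_) ?_
    · filter_upwards [hyle n] with t ht
      rw [norm_mul, norm_mul]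
      gcongr
    · filter_upwards [hev] with t ht
      refine tendsto_const_nhds.congr' ?_
      filter_upwards [ht] with n hn
      rw [hn]
  have h2 : Tendsto y atTop (𝓝 x) := by
    rw [tendsto_iff_norm_sub_tendsto_zero]
    have h3 := tendsto_norm_cut hK hX.norming x hA hanti (.of_forall fun t => (hAt t).exists)
    refine h3.congr fun n => ?_
    rw [norm_sub_rev]
    congr 1
    exact eq_sub_of_add_eq (cut_add_cut_compl hK (hA n) x)
  exact tendsto_nhds_unique ((φ.continuous.tendsto x).comp h2) h1

end Representation

/-! ### Spear densities and the sets that carry their norm. -/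

section Density

open Filter Topology

variable {𝕜 : Type*} [RCLike 𝕜] {X : Type*} [NormedAddCommGroup X] [NormedSpace 𝕜 X]
  {ι : X →ₗ[𝕜] (I →ₘ[(volume : Measure I)] 𝕜)}

/-- `G` is the density of an integral functional of norm at most one. -/
structure IsUnitDensity (ι : X →ₗ[𝕜] (I →ₘ[(volume : Measure I)] 𝕜)) (G : I → 𝕜) : Prop where
  measurable : Measurable G
  integrable : ∀ x : X, Integrable (fun t => ι x t * G t) volume
  integral_norm_le : ∀ x : X, ∫ t, ‖ι x t * G t‖ ≤ ‖x‖

/-- A unit density `g` such that every unit density almost attains its norm on each slice of the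
ball given by `g`. -/
structure IsSpearDensity (ι : X →ₗ[𝕜] (I →ₘ[(volume : Measure I)] 𝕜)) (g : I → 𝕜) : Prop
    extends IsUnitDensity ι g where
  exists_norming : ∀ (G : I → 𝕜) (_ : IsUnitDensity ι G) (x : X) (_ : ‖x‖ ≤ 1) (δ : ℝ) (_ : 0 < δ),
    ∃ z : X, ‖z‖ ≤ 1 ∧ 1 - δ < RCLike.re (∫ t, ι z t * g t) ∧
      (∫ t, ‖ι x t * G t‖) - δ < ‖∫ t, ι z t * G t‖

lemma integral_norm_le_of_apply_eq (hX : IsKotheFunctionSpace ι) {φ : StrongDual 𝕜 X}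
    {G : I → 𝕜} (hG : Measurable G)
    (h : ∀ x, Integrable (fun t => ι x t * G t) volume ∧ φ x = ∫ t, ι x t * G t) (x : X) :
    ∫ t, ‖ι x t * G t‖ ≤ ‖φ‖ * ‖x‖ := by
  have h1 := lintegral_le_of_forall_apply_eq hX φ hG x (h x).1 fun y _ => (h y).2
  simp_rw [← enorm_mul] at h1
  rwa [← ofReal_integral_norm_eq_lintegral_enorm (h x).1, ← ofReal_norm φ, ← ofReal_norm x,
    ← ENNReal.ofReal_mul (norm_nonneg _), ENNReal.ofReal_le_ofReal_iff (by positivity)] at h1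

lemma IsUnitDensity.exists_functional {G : I → 𝕜} (hG : IsUnitDensity ι G) :
    ∃ φ : StrongDual 𝕜 X, ‖φ‖ ≤ 1 ∧
      ∀ x, Integrable (fun t => ι x t * G t) volume ∧ φ x = ∫ t, ι x t * G t := by
  refine exists_functional_of_lintegral_le hG.measurable fun x => ?_
  simp_rw [← enorm_mul]
  rw [← ofReal_integral_norm_eq_lintegral_enorm (hG.integrable x), ← ofReal_norm x]
  exact ENNReal.ofReal_le_ofReal (hG.integral_norm_le x)

lemma IsUnitDensity.mono {g G : I → 𝕜} (hg : IsUnitDensity ι g) (hG : Measurable G)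
    (h : ∀ t, ‖G t‖ ≤ ‖g t‖) : IsUnitDensity ι G := by
  have hle : ∀ (x : X) t, ‖ι x t * G t‖ ≤ ‖ι x t * g t‖ := fun x t => by
    rw [norm_mul, norm_mul]
    gcongr
    exact h t
  have hi : ∀ x : X, Integrable (fun t => ι x t * G t) volume := fun x =>
    (hg.integrable x).mono ((measurable_coeFn x).mul hG).aestronglyMeasurable
      (.of_forall (hle x))
  exact ⟨hG, hi, fun x => (integral_mono (hi x).norm (hg.integrable x).norm (hle x)).trans
    (hg.integral_norm_le x)⟩

theorem IsSpear.exists_density [TopologicalSpace.SeparableSpace X]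
    (hX : IsRearrangementInvariant ι) {φ : StrongDual 𝕜 X} (hφ : IsSpear φ) :
    ∃ g : I → 𝕜, IsSpearDensity ι g ∧ ∀ x, φ x = ∫ t, ι x t * g t := by
  obtain ⟨g, hg, hgφ⟩ := RISpace.exists_density hX φ
  refine ⟨g, ⟨⟨hg, fun x => (hgφ x).1, fun x => ?_⟩, fun G hG x hx δ hδ => ?_⟩,
    fun x => (hgφ x).2⟩
  · exact (integral_norm_le_of_apply_eq hX.toIsKotheFunctionSpace hg hgφ x).trans
      (mul_le_of_le_one_left (norm_nonneg _) hφ.1)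
  · obtain ⟨h, -, hh⟩ := hG.exists_functional
    obtain ⟨z, hz, hz1, hz2⟩ := hφ.2 h δ hδ
    refine ⟨z, hz, (hgφ z).2 ▸ hz1, (hh z).2 ▸ lt_of_le_of_lt ?_ hz2⟩
    have := integral_norm_le_of_apply_eq hX.toIsKotheFunctionSpace hG.measurable hh x
    have := this.trans (mul_le_of_le_one_right (norm_nonneg h) hx)
    linarith

/-- The functional with density `g` attains its norm one on functions supported in `B`. -/
def IsFull (ι : X →ₗ[𝕜] (I →ₘ[(volume : Measure I)] 𝕜)) (g : I → 𝕜) (B : Set I) : Prop :=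
  ∀ ε : ℝ, 0 < ε → ∃ z : X, ‖z‖ ≤ 1 ∧ 1 - ε < ∫ t in B, ‖ι z t * g t‖

lemma IsSpearDensity.isFull_univ {g : I → 𝕜} (hg : IsSpearDensity ι g) : IsFull ι g univ := by
  intro ε hε
  obtain ⟨z, hz, h1, -⟩ := hg.exists_norming g hg.toIsUnitDensity 0 (by simp) ε hε
  refine ⟨z, hz, h1.trans_le ?_⟩
  rw [setIntegral_univ]
  exact (RCLike.re_le_norm _).trans (norm_integral_le_integral_norm _)

lemma not_isFull_of_null {g : I → 𝕜} {B : Set I} (hB : volume B = 0) : ¬IsFull ι g B := by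
  intro h
  obtain ⟨z, -, hz⟩ := h 1 one_pos
  rw [Measure.restrict_eq_zero.2 hB, integral_zero_measure] at hz
  norm_num at hz

/-- Test the spear against `g` with its sign changed on `B'`. For the resulting `z`, the integrals
`β`, `β'` of `z g` over `B`, `B'` have `|β + β'|` and `|β - β'|` both near 1, though `|β| + |β'| ≤
1`. The parallelogram law puts nearly all the mass in one of them. -/
lemma IsSpearDensity.isFull_or {g : I → 𝕜} (hg : IsSpearDensity ι g) {B B' : Set I}
    (hB : MeasurableSet B) (hB' : MeasurableSet B') (hd : Disjoint B B')
    (h : IsFull ι g (B ∪ B')) : IsFull ι g B ∨ IsFull ι g B' := by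
  by_contra! hcon
  obtain ⟨hc, hc'⟩ := hcon
  simp only [IsFull, not_forall, not_exists, not_and, not_lt] at hc hc'
  obtain ⟨ε₁, hε₁, hc⟩ := hc
  obtain ⟨ε₂, hε₂, hc'⟩ := hc'
  set ε := min (min ε₁ ε₂) 1 with hε
  have hε0 : 0 < ε := by positivity
  have hεle₁ : ε ≤ ε₁ := (min_le_left _ _).trans (min_le_left _ _)
  have hεle₂ : ε ≤ ε₂ := (min_le_left _ _).trans (min_le_right _ _)
  have hεle : ε ≤ 1 := min_le_right _ _
  -- The parallelogram law will give `(1 - 3 * δ) ^ 2 ≤ 1 - ε`, whereas `(1 - 3 * δ) ^ 2 ≥ 1 - 6 * δ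
  -- = 1 - ε / 2`.
  set δ := ε / 12 with hδ
  have hδ0 : 0 < δ := by positivity
  let G : I → 𝕜 := fun t => B.indicator g t - B'.indicator g t
  have hGm : Measurable G := (hg.measurable.indicator hB).sub (hg.measurable.indicator hB')
  have hGg : ∀ t, ‖G t‖ ≤ ‖g t‖ := fun t => by
    by_cases ht : t ∈ B
    · simp [G, ht, disjoint_left.1 hd ht]
    · by_cases ht' : t ∈ B' <;> simp [G, ht, ht']
  have hG : IsUnitDensity ι G := hg.toIsUnitDensity.mono hGm hGg
  obtain ⟨x, hx, hx1⟩ := h δ hδ0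
  obtain ⟨z, hz, hz1, hz2⟩ := hg.exists_norming G hG x hx δ hδ0
  have hxG : ∫ t in B ∪ B', ‖ι x t * g t‖ ≤ ∫ t, ‖ι x t * G t‖ := by
    rw [← integral_indicator (hB.union hB')]
    refine integral_mono ((hg.integrable x).norm.indicator (hB.union hB'))
      (hG.integrable x).norm fun t => ?_
    by_cases ht : t ∈ B
    · simp [G, ht, disjoint_left.1 hd ht]
    · by_cases ht' : t ∈ B' <;> simp [G, ht, ht']
  have hint := hg.integrable z
  set β := ∫ t in B, ι z t * g t with hβ
  set β' := ∫ t in B', ι z t * g t with hβ'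
  set γ := ∫ t in (B ∪ B')ᶜ, ι z t * g t with hγ
  set b := ∫ t in B, ‖ι z t * g t‖ with hb
  set b' := ∫ t in B', ‖ι z t * g t‖ with hb'
  set c := ∫ t in (B ∪ B')ᶜ, ‖ι z t * g t‖ with hcc
  have hβb : ‖β‖ ≤ b := norm_integral_le_integral_norm _
  have hβb' : ‖β'‖ ≤ b' := norm_integral_le_integral_norm _
  have hγc : ‖γ‖ ≤ c := norm_integral_le_integral_norm _
  have hsum : b + b' + c ≤ 1 := by
    rw [hb, hb', hcc, ← setIntegral_union hd hB' hint.norm.integrableOn hint.norm.integrableOn,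
      integral_add_compl (hB.union hB') hint.norm]
    exact (hg.integral_norm_le z).trans hz
  have hsplit : ∫ t, ι z t * g t = β + β' + γ := by
    rw [hβ, hβ', hγ, ← setIntegral_union hd hB' hint.integrableOn hint.integrableOn,
      integral_add_compl (hB.union hB') hint]
  have hdiff : ∫ t, ι z t * G t = β - β' := by
    rw [hβ, hβ', ← integral_indicator hB, ← integral_indicator hB',
      ← integral_sub (hint.indicator hB) (hint.indicator hB')]
    refine integral_congr_ae (.of_forall fun t => ?_)
    by_cases ht : t ∈ B <;> by_cases ht' : t ∈ B' <;> simp [G, ht, ht']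
  rw [hdiff] at hz2
  rw [hsplit] at hz1
  have h1 : 1 - 2 * δ < ‖β - β'‖ := by linarith
  have h2 : c ≤ 2 * δ := by
    have := norm_sub_le β β'
    linarith
  have h3 : 1 - 3 * δ < ‖β + β'‖ := by
    have h4 := (RCLike.re_le_norm (β + β' + γ)).trans (norm_add_le _ _)
    linarith
  have hpar := parallelogram_law_with_norm 𝕜 β β'
  have hbε : b ≤ 1 - ε := (hc z hz).trans (by linarith)
  have hbε' : b' ≤ 1 - ε := (hc' z hz).trans (by linarith)
  have hb0 : 0 ≤ b := (norm_nonneg _).trans hβb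
  have hb0' : 0 ≤ b' := (norm_nonneg _).trans hβb'
  have hc0 : 0 ≤ c := (norm_nonneg _).trans hγc
  have e1 : ‖β‖ * ‖β‖ ≤ b * (1 - ε) := mul_le_mul hβb (hβb.trans hbε) (norm_nonneg _) hb0
  have e2 : ‖β'‖ * ‖β'‖ ≤ b' * (1 - ε) := mul_le_mul hβb' (hβb'.trans hbε') (norm_nonneg _) hb0'
  have hδ1 : 0 ≤ 1 - 3 * δ := by linarith
  have e3 : (1 - 3 * δ) * (1 - 3 * δ) ≤ ‖β + β'‖ * ‖β + β'‖ :=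
    mul_le_mul h3.le h3.le hδ1 (norm_nonneg _)
  have e4 : (1 - 3 * δ) * (1 - 3 * δ) ≤ ‖β - β'‖ * ‖β - β'‖ :=
    mul_le_mul (by linarith) (by linarith) hδ1 (norm_nonneg _)
  have e5 : (b + b') * (1 - ε) ≤ 1 * (1 - ε) :=
    mul_le_mul_of_nonneg_right (by linarith) (by linarith)
  nlinarith

lemma IsSpearDensity.exists_isFull_level {g : I → 𝕜} (hg : IsSpearDensity ι g) {α : I → ℕ}
    (hα : Measurable α) (n : ℕ) (h : IsFull ι g {t | α t < n}) :
    ∃ j < n, IsFull ι g (α ⁻¹' {j}) := by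
  induction n with
  | zero => exact absurd h (not_isFull_of_null (by simp))
  | succ n ih =>
    have hset : {t | α t < n + 1} = {t | α t < n} ∪ α ⁻¹' {n} := by
      ext t
      simp only [mem_ofPred_eq, mem_union, mem_preimage, mem_singleton_iff]
      omega
    rw [hset] at h
    rcases hg.isFull_or (measurableSet_lt hα measurable_const) (hα (measurableSet_singleton n))
      (disjoint_left.2 fun t (h1 : α t < n) (h2 : α t = n) => h1.ne h2) h with h | h
    · obtain ⟨j, hj, hfull⟩ := ih h
      exact ⟨j, hj.trans n.lt_succ_self, hfull⟩
    · exact ⟨n, n.lt_succ_self, h⟩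

lemma IsRearrangementInvariant.integrable (hX : IsRearrangementInvariant ι) (x : X) :
    Integrable (ι x) volume :=
  memLp_one_iff_integrable.1 (hX.le_lone x).1

lemma IsRearrangementInvariant.integral_norm_le (hX : IsRearrangementInvariant ι) (x : X) :
    ∫ t, ‖ι x t‖ ≤ ‖x‖ := by
  have h := (hX.le_lone x).2
  rwa [eLpNorm_one_eq_lintegral_enorm,
    ← ofReal_integral_norm_eq_lintegral_enorm (hX.integrable x), ← ofReal_norm x,
    ENNReal.ofReal_le_ofReal_iff (norm_nonneg _)] at h

lemma IsRearrangementInvariant.exists_comp (hX : IsRearrangementInvariant ι) {τ : I ≃ᵐ I}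
    (hτ : MeasurePreserving τ volume volume) (x : X) :
    ∃ y : X, (ι y =ᵐ[volume] fun t => ι x (τ t)) ∧ ‖y‖ = ‖x‖ := by
  obtain ⟨y, hy⟩ := (hX.comp_mem_iff τ.symm hτ (ι x) (hX.integrable x)).1 ⟨x, rfl⟩
  exact ⟨y, hy ▸ AEEqFun.coeFn_compMeasurePreserving (ι x) hτ, hX.norm_comp τ.symm hτ x y hy⟩

end Density

/-! ### Unimodularity of spear densities and the identification of `X` with `L₁`. -/

section Main

open Filter Topology

variable {𝕜 : Type*} [RCLike 𝕜] {X : Type*} [NormedAddCommGroup X] [NormedSpace 𝕜 X]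
  {ι : X →ₗ[𝕜] (I →ₘ[(volume : Measure I)] 𝕜)}

lemma volume_eq_tsum_inter_level {u : I → ℕ} (hu : Measurable u) {S : Set I}
    (hS : MeasurableSet S) : volume S = ∑' k, volume (u ⁻¹' {k} ∩ S) := by
  have : S = ⋃ k, (u ⁻¹' {k} ∩ S) := by
    ext t
    simp
  conv_lhs => rw [this]
  refine measure_iUnion (fun i j hij => ?_)
    fun k => (hu (measurableSet_singleton k)).inter hS
  exact disjoint_left.2 fun t ht ht' => hij (ht.1.symm.trans ht'.1)

lemma levelPos_le (u : I → ℕ) (t : I) :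
    levelPos u t ≤ (volume : Measure I).real (u ⁻¹' {u t}) :=
  measureReal_mono inter_subset_left

lemma exists_subset_volume_eq {A : Set I} (hA : MeasurableSet A) {r : ℝ}
    (hrA : r ≤ (volume : Measure I).real A) :
    ∃ C ⊆ A, MeasurableSet C ∧ volume C = ENNReal.ofReal r := by
  have hc := continuous_cumul A
  refine ⟨A ∩ cumul A ⁻¹' Iic r, inter_subset_left,
    hA.inter (hc.measurable measurableSet_Iic), ?_⟩
  have h := congrArg (fun μ => μ (Iic r)) (map_cumul A)
  rw [Measure.map_apply hc.measurable measurableSet_Iic,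
    Measure.restrict_apply (hc.measurable measurableSet_Iic), inter_comm] at h
  rw [h, Measure.restrict_apply measurableSet_Iic]
  have : Iic r ∩ Icc 0 ((volume : Measure I).real A) = Icc 0 r := by
    ext s
    simp only [mem_inter_iff, mem_Iic, mem_Icc]
    exact ⟨fun h => ⟨h.2.1, h.1⟩, fun h => ⟨h.2, h.1, h.2.trans hrA⟩⟩
  rw [this, Real.volume_Icc, sub_zero]

/-- The level sets of `u` can be simultaneously divided into `m` parts of equal measure. -/
lemma exists_equidistributed {u : I → ℕ} (hu : Measurable u) {m : ℕ} (hm : 0 < m) :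
    ∃ α : I → ℕ, Measurable α ∧ (∀ t, α t < m + 1) ∧ volume (α ⁻¹' {0}) = 0 ∧
      ∀ k j, 0 < j → j ≤ m →
        volume (u ⁻¹' {k} ∩ α ⁻¹' {j}) = volume (u ⁻¹' {k}) / m := by
  let p : ℕ → ℝ := fun k => (volume : Measure I).real (u ⁻¹' {k})
  have hp0 : ∀ k, 0 ≤ p k := fun k => measureReal_nonneg
  have hm' : (0 : ℝ) < m := by exact_mod_cast hm
  -- Cut the range `[0, p k]` of positions into `m` equal half-open intervals. The extra value 0
  -- occurs at position 0, and on levels of measure zero, where the quotient is 0 by convention; it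
  -- has measure zero.
  let α : I → ℕ := fun t => ⌈m * levelPos u t / p (u t)⌉₊
  have hpu : Measurable fun t => p (u t) := (measurable_from_nat (f := p)).comp hu
  have hα : Measurable α :=
    Nat.measurable_ceil.comp (((measurable_levelPos hu).const_mul _).div hpu)
  have hlevel : ∀ k j, volume (u ⁻¹' {k} ∩ α ⁻¹' {j}) =
      volume ({s : ℝ | ⌈m * s / p k⌉₊ = j} ∩ Icc 0 (p k)) := by
    intro k j
    have hS : MeasurableSet {s : ℝ | ⌈m * s / p k⌉₊ = j} :=
      measurableSet_eq_fun (Nat.measurable_ceil.comp (by fun_prop)) measurable_const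
    rw [← volume_level_inter_levelPos u k hS]
    congr 1
    ext t
    simp only [mem_inter_iff, mem_preimage, mem_singleton_iff, mem_ofPred_eq,
      and_congr_right_iff, α]
    rintro rfl
    rfl
  have hnull : ∀ k, p k = 0 → volume (u ⁻¹' {k}) = 0 := fun k hk =>
    (measureReal_eq_zero_iff).1 hk
  refine ⟨α, hα, fun t => ?_, ?_, fun k j hj hjm => ?_⟩
  · refine Nat.lt_succ_of_le (Nat.ceil_le.2 ?_)
    refine div_le_of_le_mul₀ (hp0 _) hm'.le ?_
    exact mul_le_mul_of_nonneg_left (levelPos_le u t) hm'.le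
  · rw [volume_eq_tsum_inter_level hu (hα (measurableSet_singleton 0)), ENNReal.tsum_eq_zero]
    intro k
    rcases (hp0 k).eq_or_lt with hk | hk
    · exact measure_mono_null inter_subset_left (hnull k hk.symm)
    · rw [hlevel]
      refine measure_mono_null (t := {0}) ?_ (measure_singleton _)
      rintro s ⟨hs, hs0, -⟩
      rw [mem_ofPred_eq, Nat.ceil_eq_zero] at hs
      have : m * s ≤ 0 := by
        by_contra! h
        exact hs.not_gt (div_pos h hk)
      refine le_antisymm ?_ hs0
      by_contra! h
      exact this.not_gt (mul_pos hm' h)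
  · rcases (hp0 k).eq_or_lt with hk | hk
    · rw [hnull k hk.symm, ENNReal.zero_div]
      exact measure_mono_null inter_subset_left (hnull k hk.symm)
    · have hset : {s : ℝ | ⌈m * s / p k⌉₊ = j} ∩ Icc 0 (p k) =
          Ioc (((j - 1 : ℕ) : ℝ) * p k / m) (j * p k / m) := by
        ext s
        have hj' : (j : ℝ) ≤ m := by exact_mod_cast hjm
        simp only [mem_inter_iff, mem_ofPred_eq, Nat.ceil_eq_iff hj.ne', mem_Ioc, mem_Icc,
          lt_div_iff₀ hk, div_le_iff₀ hk, div_lt_iff₀ hm', le_div_iff₀ hm']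
        constructor
        · rintro ⟨⟨h1, h2⟩, -⟩
          exact ⟨by linarith, by linarith⟩
        · rintro ⟨h1, h2⟩
          refine ⟨⟨by linarith, by linarith⟩, ?_, ?_⟩
          · by_contra! h
            have h3 : 0 ≤ ((j - 1 : ℕ) : ℝ) * p k := by positivity
            nlinarith
          · have h3 := mul_le_mul_of_nonneg_right hj' hk.le
            by_contra! h
            nlinarith
      rw [hlevel, hset, Real.volume_Ioc, Nat.cast_pred hj,
        show (j * p k / m - (j - 1) * p k / m : ℝ) = p k / m by ring,
        ENNReal.ofReal_div_of_pos hm', ofReal_measureReal, ENNReal.ofReal_natCast]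

/-- Replacing a part of a unit density by an almost equimeasurable copy placed elsewhere. -/
lemma integral_add_integral_transport_le (hX : IsRearrangementInvariant ι) {g : I → 𝕜}
    (hg : IsUnitDensity ι g) {B B' C : Set I} (hB : MeasurableSet B) (hB' : MeasurableSet B')
    (hC : MeasurableSet C) {τ : I ≃ᵐ I} (hτ : MeasurePreserving τ volume volume)
    (hτB : ∀ᵐ t : I, τ t ∈ B ↔ t ∈ C) {u : I → ℕ} (hu : Measurable u)
    (hBB' : ∀ k, volume (u ⁻¹' {k} ∩ B) = volume (u ⁻¹' {k} ∩ B')) {δ : ℝ} (hδ : 0 ≤ δ)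
    (huδ : ∀ s t, u s = u t → ‖g s‖ ≤ ‖g t‖ + δ) {z : X} (hz : ‖z‖ ≤ 1)
    (hG : IsUnitDensity ι (C.indicator fun t => g (τ t))) :
    (∫ t in Cᶜ \ B', ‖ι z t * g t‖) + ∫ t, ‖ι z t * C.indicator (fun t => g (τ t)) t‖ ≤ 1 + δ := by
  classical
  -- Coded so that a bijection `ρ` with `U ∘ ρ = U'` a.e. carries `B'` into `C`, matching `u` with
  -- `u ∘ τ` (values from 2 on), carries `C \ B'` into `B' \ C` (value 1), and can be the identity
  -- elsewhere (value 0).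
  let U : I → ℕ := fun t => if t ∈ C then u (τ t) + 2 else if t ∈ B' then 1 else 0
  let U' : I → ℕ := fun t => if t ∈ B' then u t + 2 else if t ∈ C then 1 else 0
  have hU : Measurable U := Measurable.ite hC ((measurable_from_nat (f := (· + 2))).comp
    (hu.comp τ.measurable)) (Measurable.ite hB' measurable_const measurable_const)
  have hU' : Measurable U' := Measurable.ite hB' ((measurable_from_nat (f := (· + 2))).comp hu)
    (Measurable.ite hC measurable_const measurable_const)
  have hvol : ∀ {S : Set I}, MeasurableSet S → volume (C ∩ τ ⁻¹' S) = volume (S ∩ B) := by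
    intro S hS
    rw [← hτ.measure_preimage (hS.inter hB).nullMeasurableSet]
    refine measure_congr ?_
    filter_upwards [hτB] with t ht
    exact propext ⟨fun h => ⟨h.2, ht.2 h.1⟩, fun h => ⟨ht.1 h.2, h.1⟩⟩
  have hCB' : volume C = volume B' := by
    have h1 := hvol MeasurableSet.univ
    rw [preimage_univ, inter_univ, univ_inter, volume_eq_tsum_inter_level hu hB] at h1
    rw [h1, volume_eq_tsum_inter_level hu hB']
    exact tsum_congr hBB'
  have hzero : U ⁻¹' {0} = U' ⁻¹' {0} := by
    ext t
    simp only [mem_preimage, mem_singleton_iff, U, U']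
    split_ifs <;> simp
  have hlaw : ∀ k, volume (U ⁻¹' {k}) = volume (U' ⁻¹' {k}) := by
    rintro (_ | _ | k)
    · rw [hzero]
    · have h1 : U ⁻¹' {0 + 1} = B' \ C := by
        ext t
        simp only [mem_preimage, mem_singleton_iff, U, Set.mem_sdiff]
        split_ifs <;> simp_all
      have h2 : U' ⁻¹' {0 + 1} = C \ B' := by
        ext t
        simp only [mem_preimage, mem_singleton_iff, U', Set.mem_sdiff]
        split_ifs <;> simp_all
      have h3 := measure_inter_add_sdiff (μ := (volume : Measure I)) B' hC
      have h4 := measure_inter_add_sdiff (μ := (volume : Measure I)) C hB'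
      rw [inter_comm, ← hCB', ← h4] at h3
      rw [h1, h2]
      exact (ENNReal.add_right_inj (measure_ne_top _ _)).1 h3
    · have h1 : U ⁻¹' {k + 1 + 1} = C ∩ τ ⁻¹' (u ⁻¹' {k}) := by
        ext t
        simp only [mem_preimage, mem_singleton_iff, U, mem_inter_iff]
        split_ifs <;> simp_all
      have h2 : U' ⁻¹' {k + 1 + 1} = u ⁻¹' {k} ∩ B' := by
        ext t
        simp only [mem_preimage, mem_singleton_iff, U', mem_inter_iff]
        split_ifs <;> simp_all
      rw [h1, h2, hvol (hu (measurableSet_singleton k)), hBB']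
  obtain ⟨ρ, hρ, hρU, hρfix⟩ := exists_measurePreserving_level hU hU' hlaw
  obtain ⟨y, hy, hyn⟩ := hX.exists_comp hρ z
  set G : I → 𝕜 := C.indicator fun t => g (τ t) with hGdef
  have hcomp : Integrable (fun t => ‖ι z (ρ t) * G (ρ t)‖) volume :=
    hρ.integrable_comp_of_integrable (hG.integrable z).norm
  have hWeq : ∫ t, ‖ι z t * G t‖ = ∫ t, ‖ι z (ρ t) * G (ρ t)‖ :=
    (hρ.integral_comp ρ.measurableEmbedding (fun t => ‖ι z t * G t‖)).symm
  have hS : MeasurableSet (Cᶜ \ B') := hC.compl.diff hB'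
  rw [hWeq, ← integral_indicator hS, ← integral_add ((hg.integrable z).norm.indicator hS) hcomp]
  -- The rearranged function `y = z ∘ ρ` pays for both terms: off `C ∪ B'` it equals `z`, and on
  -- `B'` it meets values of `|g|` that are at most `δ` below those of the copy at `ρ t`.
  have hle : ∫ t, ((Cᶜ \ B').indicator (fun t => ‖ι z t * g t‖) t + ‖ι z (ρ t) * G (ρ t)‖) ≤
      ∫ t, (‖ι y t * g t‖ + δ * ‖ι y t‖) := by
    refine integral_mono_ae (((hg.integrable z).norm.indicator hS).add hcomp)
      ((hg.integrable y).norm.add ((hX.integrable y).norm.const_mul δ)) ?_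
    filter_upwards [hy, hρU, hρfix 0 hzero] with t hyt hUt hfix
    rw [hyt]
    by_cases htB : t ∈ B'
    · have hU't : U' t = u t + 2 := if_pos htB
      rw [hU't] at hUt
      have hρC : ρ t ∈ C := by
        by_contra h
        simp only [U, if_neg h] at hUt
        split_ifs at hUt; omega
      simp only [U, if_pos hρC, Nat.add_right_cancel_iff] at hUt
      rw [indicator_of_notMem (fun h => h.2 htB), hGdef, indicator_of_mem hρC, zero_add, norm_mul,
        norm_mul]
      nlinarith [norm_nonneg (ι z (ρ t)), huδ _ _ hUt]
    · have hR : 0 ≤ δ * ‖ι z (ρ t)‖ := by positivity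
      have hR' : 0 ≤ ‖ι z (ρ t) * g t‖ := norm_nonneg _
      by_cases htC : t ∈ C
      · have hU't : U' t = 1 := by simp [U', htB, htC]
        rw [hU't] at hUt
        have hρC : ρ t ∉ C := fun h => by simp [U, h] at hUt
        rw [indicator_of_notMem (fun h => h.1 htC), hGdef, indicator_of_notMem hρC]
        simp only [mul_zero, norm_zero, add_zero]
        exact add_nonneg hR' hR
      · have hU't : U' t = 0 := by simp [U', htB, htC]
        rw [hfix hU't] at hR ⊢
        rw [indicator_of_mem (show t ∈ Cᶜ \ B' from ⟨htC, htB⟩), hGdef, indicator_of_notMem htC]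
        simp only [mul_zero, norm_zero]
        linarith
  refine hle.trans ?_
  rw [integral_add (hg.integrable y).norm ((hX.integrable y).norm.const_mul δ),
    integral_const_mul]
  have h1 := hg.integral_norm_le y
  have h2 := mul_le_mul_of_nonneg_left (hX.integral_norm_le y) hδ
  nlinarith

lemma integral_transport {g : I → 𝕜} (hg : IsUnitDensity ι g) {B C : Set I}
    (hB : MeasurableSet B) {τ : I ≃ᵐ I} (hτ : MeasurePreserving τ volume volume)
    (hτB : ∀ᵐ t : I, τ t ∈ B ↔ t ∈ C) {x y : X} (hxy : ι x =ᵐ[volume] fun t => ι y (τ t)) :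
    Integrable (fun t => ι x t * C.indicator (fun t => g (τ t)) t) volume ∧
      ∫ t, ‖ι x t * C.indicator (fun t => g (τ t)) t‖ = ∫ t in B, ‖ι y t * g t‖ := by
  have hae : (fun t => ι x t * C.indicator (fun t => g (τ t)) t) =ᵐ[volume]
      fun t => B.indicator (fun t => ι y t * g t) (τ t) := by
    filter_upwards [hτB, hxy] with t h1 h2
    by_cases ht : t ∈ C
    · rw [indicator_of_mem ht, indicator_of_mem (h1.2 ht), h2]
    · rw [indicator_of_notMem ht, indicator_of_notMem fun h => ht (h1.1 h), mul_zero]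
  refine ⟨(hτ.integrable_comp_of_integrable ((hg.integrable y).indicator hB)).congr hae.symm, ?_⟩
  have hnorm : ∫ t, ‖ι x t * C.indicator (fun t => g (τ t)) t‖ =
      ∫ t, ‖B.indicator (fun t => ι y t * g t) (τ t)‖ := integral_congr_ae (hae.fun_comp norm)
  rw [hnorm, ← integral_indicator hB,
    ← hτ.integral_comp τ.measurableEmbedding (B.indicator fun t => ‖ι y t * g t‖)]
  simp only [norm_indicator_eq_indicator_norm]

lemma IsUnitDensity.transport (hX : IsRearrangementInvariant ι) {g : I → 𝕜}
    (hg : IsUnitDensity ι g) {B C : Set I} (hB : MeasurableSet B) (hC : MeasurableSet C)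
    {τ : I ≃ᵐ I} (hτ : MeasurePreserving τ volume volume)
    (hτB : ∀ᵐ t : I, τ t ∈ B ↔ t ∈ C) : IsUnitDensity ι (C.indicator fun t => g (τ t)) := by
  have key : ∀ x : X, ∃ y : X, (ι x =ᵐ[volume] fun t => ι y (τ t)) ∧ ‖y‖ = ‖x‖ := by
    intro x
    obtain ⟨y, hy, hyx⟩ := hX.exists_comp (hτ.symm τ) x
    refine ⟨y, ?_, hyx⟩
    filter_upwards [hτ.quasiMeasurePreserving.ae hy] with t ht
    rw [ht, τ.symm_apply_apply]
  refine ⟨(hg.measurable.comp τ.measurable).indicator hC, fun x => ?_, fun x => ?_⟩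
  · obtain ⟨y, hy, -⟩ := key x
    exact (integral_transport hg hB hτ hτB hy).1
  · obtain ⟨y, hy, hyx⟩ := key x
    rw [(integral_transport hg hB hτ hτB hy).2, ← hyx]
    exact (setIntegral_le_integral (hg.integrable y).norm
      (.of_forall fun t => norm_nonneg _)).trans (hg.integral_norm_le y)

lemma exists_measurePreserving_mem_iff {B C : Set I} (hB : MeasurableSet B)
    (hC : MeasurableSet C) (h : volume B = volume C) :
    ∃ τ : I ≃ᵐ I, MeasurePreserving τ volume volume ∧ ∀ᵐ t : I, τ t ∈ B ↔ t ∈ C := by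
  classical
  let U : Set I → I → ℕ := fun A t => if t ∈ A then 1 else 0
  have hU : ∀ {A : Set I}, MeasurableSet A → Measurable (U A) := fun hA =>
    Measurable.ite hA measurable_const measurable_const
  have hU1 : ∀ (A : Set I) t, U A t = 1 ↔ t ∈ A := fun A t => by simp [U]
  have hlaw : ∀ k, volume (U B ⁻¹' {k}) = volume (U C ⁻¹' {k}) := by
    have h0 : ∀ A : Set I, U A ⁻¹' {0} = Aᶜ := fun A => by ext t; simp [U]
    have h1 : ∀ A : Set I, U A ⁻¹' {0 + 1} = A := fun A => by ext t; simp [U]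
    have h2 : ∀ (A : Set I) (k : ℕ), U A ⁻¹' {k + 1 + 1} = ∅ := fun A k => by
      ext t
      simp only [U, mem_preimage, mem_singleton_iff, mem_empty_iff_false, iff_false]
      split_ifs <;> simp
    rintro (_ | _ | k)
    · rw [h0, h0, prob_compl_eq_one_sub hB, prob_compl_eq_one_sub hC, h]
    · rw [h1, h1, h]
    · rw [h2, h2]
  obtain ⟨τ, hτ, hτU, -⟩ := exists_measurePreserving_level (hU hB) (hU hC) hlaw
  refine ⟨τ, hτ, ?_⟩
  filter_upwards [hτU] with t ht
  rw [← hU1 B, ← hU1 C, ht]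

/-- If `|g| ≤ a < 1` on a positive set, a full piece of `g` copied into that set gives a `z` nearly
norming both `g` and the copy. Moving the copy onto any one of `M` equidistributed parts costs on
average only a fraction `1/M` of the rest, so the two contributions add up to more than 1. -/
lemma not_volume_norm_le_pos (hX : IsRearrangementInvariant ι) {g : I → 𝕜}
    (hg : IsSpearDensity ι g) {a : ℝ} (ha : a < 1) : volume {t | ‖g t‖ ≤ a} = 0 := by
  by_contra hpos
  have hgm := hg.measurable
  set C₀ : Set I := {t | ‖g t‖ ≤ a} with hC₀
  have hC₀m : MeasurableSet C₀ := measurableSet_le hgm.norm measurable_const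
  have hC₀pos : 0 < (volume : Measure I).real C₀ :=
    ENNReal.toReal_pos hpos (measure_ne_top _ _)
  have ha0 : 0 ≤ a := by
    obtain ⟨t, ht⟩ := nonempty_of_measure_ne_zero hpos
    exact (norm_nonneg _).trans ht
  -- With `a = 1 - 8 * δ`, the lower bounds below give `P + W > (1 - δ - a) + (1 - 2 * δ) = 1 + 5 *
  -- δ`, against the upper bound `1 + 2 * δ`.
  set δ := (1 - a) / 8 with hδ
  have hδ0 : 0 < δ := by rw [hδ]; linarith
  -- `1 / M` must be small enough for a set of that measure to fit in `C₀`, and below `δ` so that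
  -- the averaging loss is negligible.
  obtain ⟨m, hm⟩ := exists_nat_one_div_lt (lt_min hC₀pos hδ0)
  rw [lt_min_iff] at hm
  set M : ℕ := m + 1 with hM
  have hMpos : 0 < M := Nat.succ_pos m
  have hMr : (0 : ℝ) < M := by exact_mod_cast hMpos
  have hMcast : ((m : ℝ) + 1) = M := by rw [hM]; push_cast; ring
  rw [hMcast] at hm
  obtain ⟨C, hCsub, hC, hCvol⟩ := exists_subset_volume_eq hC₀m hm.1.le
  let u : I → ℕ := fun t => ⌊‖g t‖ / δ⌋₊
  have hu : Measurable u := Nat.measurable_floor.comp (hgm.norm.div_const δ)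
  have huδ : ∀ s t, u s = u t → ‖g s‖ ≤ ‖g t‖ + δ := by
    intro s t hst
    have h1 := Nat.lt_floor_add_one (‖g s‖ / δ)
    have h2 := Nat.floor_le (div_nonneg (norm_nonneg (g t)) hδ0.le)
    have h3 : (⌊‖g s‖ / δ⌋₊ : ℝ) = ⌊‖g t‖ / δ⌋₊ := by exact_mod_cast hst
    rw [div_lt_iff₀ hδ0] at h1
    rw [le_div_iff₀ hδ0] at h2
    rw [h3] at h1
    linarith
  obtain ⟨α, hα, hαlt, hα0, hαk⟩ := exists_equidistributed hu hMpos
  have hαm : ∀ j, MeasurableSet (α ⁻¹' {j}) := fun j => hα (measurableSet_singleton j)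
  have hαvol : ∀ j, 0 < j → j ≤ M → volume (α ⁻¹' {j}) = ENNReal.ofReal (1 / M) := by
    intro j hj hjM
    rw [volume_eq_tsum_inter_level hu (hαm j)]
    simp_rw [fun k => hαk k j hj hjM, div_eq_mul_inv]
    rw [ENNReal.tsum_mul_right]
    have h1 := volume_eq_tsum_inter_level hu MeasurableSet.univ
    simp only [inter_univ, measure_univ] at h1
    rw [← h1, one_mul, one_mul, ENNReal.ofReal_inv_of_pos hMr, ENNReal.ofReal_natCast]
  -- The part `j` carries the norm of `g` and has the measure of `C`; it is the piece to be copied.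
  obtain ⟨j, hj, hfull⟩ := hg.exists_isFull_level hα (M + 1) (by
    rw [show {t | α t < M + 1} = univ from eq_univ_of_forall hαlt]
    exact hg.isFull_univ)
  have hj0 : 0 < j := Nat.pos_of_ne_zero fun h => not_isFull_of_null (h ▸ hα0) hfull
  have hjM : j ≤ M := Nat.lt_succ_iff.1 hj
  obtain ⟨τ, hτ, hτB⟩ := exists_measurePreserving_mem_iff (hαm j) hC
    ((hαvol j hj0 hjM).trans hCvol.symm)
  have hG := hg.toIsUnitDensity.transport hX (hαm j) hC hτ hτB
  set G : I → 𝕜 := C.indicator fun t => g (τ t) with hGdef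
  obtain ⟨z₀, hz₀, hz₀j⟩ := hfull δ hδ0
  obtain ⟨x, hx, hxn⟩ := hX.exists_comp hτ z₀
  obtain ⟨z, hz, hz1, hz2⟩ := hg.exists_norming G hG x (hxn ▸ hz₀) δ hδ0
  rw [(integral_transport hg.toIsUnitDensity (hαm j) hτ hτB hx).2] at hz2
  set F : I → ℝ := fun t => ‖ι z t * g t‖ with hF
  have hFi : Integrable F volume := (hg.integrable z).norm
  have hF0 : ∀ t, 0 ≤ F t := fun t => norm_nonneg _
  set P := ∫ t in Cᶜ, F t with hP
  set W := ∫ t, ‖ι z t * G t‖ with hW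
  have hW1 : 1 - 2 * δ < W := by
    have := norm_integral_le_integral_norm (μ := (volume : Measure I)) fun t => ι z t * G t
    linarith
  have hPa : 1 - δ - a < P := by
    have h1 := (RCLike.re_le_norm _).trans
      (norm_integral_le_integral_norm (μ := (volume : Measure I)) fun t => ι z t * g t)
    have h2 : ∫ t in C, F t ≤ a := by
      have h3 : ∫ t in C, F t ≤ ∫ t in C, a * ‖ι z t‖ := by
        refine setIntegral_mono_on hFi.integrableOn
          ((hX.integrable z).norm.const_mul a).integrableOn hC fun t ht => ?_
        simp only [hF, norm_mul]
        rw [mul_comm]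
        exact mul_le_mul_of_nonneg_right (hCsub ht) (norm_nonneg _)
      have h4 : ∫ t in C, a * ‖ι z t‖ ≤ ∫ t, a * ‖ι z t‖ :=
        setIntegral_le_integral ((hX.integrable z).norm.const_mul a)
          (.of_forall fun t => mul_nonneg ha0 (norm_nonneg _))
      have h34 := h3.trans h4
      rw [integral_const_mul] at h34
      have h5 := mul_le_mul_of_nonneg_left ((hX.integral_norm_le z).trans hz) ha0
      linarith
    have h6 : (∫ t in C, F t) + P = ∫ t, F t := integral_add_compl hC hFi
    linarith
  have hP1 : P ≤ 1 := (setIntegral_le_integral hFi (.of_forall hF0)).trans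
    ((hg.integral_norm_le z).trans hz)
  -- All parts have equal measure in each level of `u`, so the copy of part `j` may be moved onto
  -- any part `i`.
  have hi : ∀ i ∈ Finset.Icc 1 M, (∫ t in Cᶜ \ α ⁻¹' {i}, F t) + W ≤ 1 + δ := by
    intro i hi
    rw [Finset.mem_Icc] at hi
    exact integral_add_integral_transport_le hX hg.toIsUnitDensity (hαm j) (hαm i) hC hτ hτB hu
      (fun k => by rw [hαk k j hj0 hjM, hαk k i hi.1 hi.2]) hδ0.le huδ hz hG
  have hsub : ∀ i, P - (∫ t in Cᶜ ∩ α ⁻¹' {i}, F t) = ∫ t in Cᶜ \ α ⁻¹' {i}, F t := by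
    intro i
    rw [hP, sub_eq_iff_eq_add, add_comm]
    exact (integral_inter_add_sdiff (hαm i) hFi.integrableOn).symm
  have hsum := Finset.sum_le_sum hi
  simp_rw [← hsub] at hsum
  rw [Finset.sum_add_distrib, Finset.sum_sub_distrib, Finset.sum_const, Finset.sum_const,
    Finset.sum_const, Nat.card_Icc, Nat.add_sub_cancel] at hsum
  simp only [nsmul_eq_mul] at hsum
  have hparts : ∑ i ∈ Finset.Icc 1 M, ∫ t in Cᶜ ∩ α ⁻¹' {i}, F t ≤ P := by
    rw [← integral_biUnion_finset _ (fun i _ => hC.compl.inter (hαm i)) _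
      fun i _ => hFi.integrableOn]
    · exact setIntegral_mono_set hFi.integrableOn (.of_forall hF0)
        (LE.le.eventuallyLE (iUnion₂_subset fun i _ => inter_subset_left))
    · intro i _ i' _ hii
      exact disjoint_left.2 fun t ht ht' => hii (ht.2.symm.trans ht'.2)
  have hMδ : 1 < δ * M := by
    have := hm.2
    rwa [div_lt_iff₀ hMr] at this
  -- The pieces removed from `P` over all `i` sum to at most `P ≤ 1 < δ * M`.
  have hfin : M * (P + W) ≤ M * (1 + 2 * δ) := by nlinarith
  have := le_of_mul_le_mul_left hfin hMr
  linarith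

/-- A spear density is unimodular. -/
theorem IsSpearDensity.norm_eq_one (hX : IsRearrangementInvariant ι) {g : I → 𝕜}
    (hg : IsSpearDensity ι g) : ∀ᵐ t : I, ‖g t‖ = 1 := by
  have hge : ∀ᵐ t : I, 1 ≤ ‖g t‖ := by
    have h : ∀ n : ℕ, ∀ᵐ t : I, ¬‖g t‖ ≤ 1 - 1 / ((n : ℝ) + 1) := fun n =>
      measure_eq_zero_iff_ae_notMem.1
        (not_volume_norm_le_pos hX hg (sub_lt_self 1 (by positivity)))
    filter_upwards [ae_all_iff.2 h] with t ht
    by_contra! hlt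
    obtain ⟨n, hn⟩ := exists_nat_one_div_lt (sub_pos.2 hlt)
    exact ht n (by linarith)
  obtain ⟨x, hx, hxn⟩ := hX.exists_of_bounded (f := fun _ => (1 : 𝕜)) measurable_const (C := 1)
    fun _ => by simp
  have hxg : (fun t => ι x t * g t) =ᵐ[volume] g := by
    filter_upwards [hx] with t ht
    rw [ht, one_mul]
  have hgi : Integrable g volume := (hg.integrable x).congr hxg
  -- Testing `g` on the constant function 1, of norm at most 1, gives the integral bound which, with
  -- `|g| ≥ 1` a.e., forces equality.
  have hle : ∫ t, ‖g t‖ ≤ 1 := by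
    have hnorm : ∫ t, ‖ι x t * g t‖ = ∫ t, ‖g t‖ := integral_congr_ae (hxg.fun_comp norm)
    rw [← hnorm]
    exact (hg.integral_norm_le x).trans hxn
  have hnn : 0 ≤ᵐ[volume] fun t => ‖g t‖ - 1 := by
    filter_upwards [hge] with t ht using sub_nonneg.2 ht
  have hint : Integrable (fun t => ‖g t‖ - 1) (volume : Measure I) :=
    hgi.norm.sub (integrable_const 1)
  have h0 : ∫ t, (‖g t‖ - 1) = 0 := by
    refine le_antisymm ?_ (integral_nonneg_of_ae hnn)
    rw [integral_sub hgi.norm (integrable_const 1)]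
    simpa using hle
  filter_upwards [(integral_eq_zero_iff_of_nonneg_ae hnn hint).1 h0] with t ht
  exact sub_eq_zero.1 ht

theorem norm_eq_integral_norm [TopologicalSpace.SeparableSpace X]
    (hX : IsRearrangementInvariant ι) (hlush : IsLush 𝕜 X) (x : X) : ‖x‖ = ∫ t, ‖ι x t‖ := by
  refine le_antisymm ?_ (hX.integral_norm_le x)
  rcases eq_or_ne x 0 with rfl | hx
  · rw [norm_zero]
    exact integral_nonneg fun _ => norm_nonneg _
  have : Nontrivial X := ⟨⟨x, 0, hx⟩⟩
  have hn : 0 < ‖x‖ := norm_pos_iff.2 hx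
  have hx1 : ‖((‖x‖⁻¹ : ℝ) : 𝕜) • x‖ = 1 := by
    rw [norm_smul, RCLike.norm_of_nonneg (by positivity), inv_mul_cancel₀ hn.ne']
  have key : ∀ η : ℝ, 0 < η → η < 1 → (1 - η) * ‖x‖ ≤ ∫ t, ‖ι x t‖ := by
    intro η hη hη1
    obtain ⟨φ, hφ, hφx⟩ := hlush.exists_isSpear hx1 hη hη1
    obtain ⟨g, hg, hφg⟩ := hφ.exists_density hX
    rw [map_smul, smul_eq_mul, RCLike.re_ofReal_mul, ← div_eq_inv_mul, le_div_iff₀ hn] at hφx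
    refine hφx.trans ((RCLike.re_le_norm _).trans ?_)
    rw [hφg]
    refine (norm_integral_le_integral_norm _).trans (le_of_eq (integral_congr_ae ?_))
    filter_upwards [hg.norm_eq_one hX] with t ht
    rw [norm_mul, ht, mul_one]
  refine le_of_forall_pos_lt_add fun ε hε => ?_
  set η := min (1 / 2) (ε / (2 * ‖x‖)) with hη
  have hη0 : 0 < η := by positivity
  have h1 := key η hη0 ((min_le_left _ _).trans_lt (by norm_num))
  have h2 : η * ‖x‖ ≤ ε / 2 := by
    have := mul_le_mul_of_nonneg_right (min_le_right (1 / 2) (ε / (2 * ‖x‖))) hn.le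
    refine this.trans (le_of_eq ?_)
    field_simp
  linarith

/-- The bounded truncations of `f` lie in `X` and converge in `L₁`. As the two norms agree they are
Cauchy in `X`, and completeness supplies a limit, necessarily `f`. -/
lemma exists_of_integrable (hX : IsRearrangementInvariant ι)
    (hnorm : ∀ x : X, ‖x‖ = ∫ t, ‖ι x t‖) {f : I →ₘ[(volume : Measure I)] 𝕜}
    (hf : Integrable f volume) : ∃ x : X, ι x = f := by
  have := hX.complete
  have hm : Measurable f := (AEEqFun.stronglyMeasurable f).measurable
  let A : ℕ → Set I := fun n => {t | ‖f t‖ ≤ n}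
  have hA : ∀ n, MeasurableSet (A n) := fun n => measurableSet_le hm.norm measurable_const
  have hbd : ∀ n t, ‖(A n).indicator f t‖ ≤ n := fun n t => by
    by_cases h : t ∈ A n
    · rw [indicator_of_mem h]
      exact h
    · rw [indicator_of_notMem h, norm_zero]
      exact n.cast_nonneg
  choose x hx _ using fun n => hX.exists_of_bounded (hm.indicator (hA n)) (hbd n)
  have hdi : ∀ n, Integrable (fun t => (A n).indicator f t - f t) volume := fun n =>
    (hf.indicator (hA n)).sub hf
  have hlim : Tendsto (fun n => ∫ t, ‖(A n).indicator f t - f t‖) atTop (𝓝 0) := by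
    rw [← integral_zero I ℝ (μ := volume)]
    refine tendsto_integral_of_dominated_convergence (fun t => ‖f t‖)
      (fun n => (hdi n).norm.aestronglyMeasurable) hf.norm (fun n => .of_forall fun t => ?_)
      (.of_forall fun t => ?_)
    · by_cases h : t ∈ A n <;> simp [h]
    · refine tendsto_const_nhds.congr' ?_
      filter_upwards [eventually_ge_atTop ⌈‖f t‖⌉₊] with n hn
      rw [indicator_of_mem (show t ∈ A n from Nat.ceil_le.1 hn), sub_self, norm_zero]
  have hcauchy : CauchySeq x := by
    rw [Metric.cauchySeq_iff]
    intro ε hε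
    obtain ⟨N, hN⟩ := eventually_atTop.1 (hlim.eventually (gt_mem_nhds (half_pos hε)))
    refine ⟨N, fun m hm n hn => ?_⟩
    rw [dist_eq_norm, hnorm]
    have h1 : ∫ t, ‖ι (x m - x n) t‖ ≤
        ∫ t, (‖(A m).indicator f t - f t‖ + ‖(A n).indicator f t - f t‖) := by
      refine integral_mono_ae (hX.integrable _).norm ((hdi m).norm.add (hdi n).norm) ?_
      rw [map_sub]
      filter_upwards [hx m, hx n, AEEqFun.coeFn_sub (ι (x m)) (ι (x n))] with t e1 e2 e3
      rw [e3, Pi.sub_apply, e1, e2, ← sub_sub_sub_cancel_right _ _ (f t)]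
      exact norm_sub_le _ _
    rw [integral_add (hdi m).norm (hdi n).norm] at h1
    linarith [hN m hm, hN n hn]
  obtain ⟨y, hy⟩ := cauchySeq_tendsto_of_complete hcauchy
  refine ⟨y, AEEqFun.ext ?_⟩
  have hyf : Integrable (fun t => ι y t - f t) volume := (hX.integrable y).sub hf
  have hle : ∀ n, ∫ t, ‖ι y t - f t‖ ≤ ‖y - x n‖ + ∫ t, ‖(A n).indicator f t - f t‖ := by
    intro n
    rw [hnorm, ← integral_add (hX.integrable _).norm (hdi n).norm]
    refine integral_mono_ae hyf.norm ((hX.integrable _).norm.add (hdi n).norm) ?_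
    rw [map_sub]
    filter_upwards [hx n, AEEqFun.coeFn_sub (ι y) (ι (x n))] with t e1 e2
    rw [e2, Pi.sub_apply, e1, ← sub_add_sub_cancel (ι y t) ((A n).indicator f t) (f t)]
    exact norm_add_le _ _
  have hlim' : Tendsto (fun n => ‖y - x n‖ + ∫ t, ‖(A n).indicator f t - f t‖) atTop (𝓝 0) := by
    have h := (tendsto_iff_norm_sub_tendsto_zero.1 hy).add hlim
    rw [add_zero] at h
    exact h.congr fun n => by rw [norm_sub_rev]
  have h0 : ∫ t, ‖ι y t - f t‖ = 0 :=
    le_antisymm (ge_of_tendsto' hlim' hle) (integral_nonneg fun _ => norm_nonneg _)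
  filter_upwards [(integral_eq_zero_iff_of_nonneg (fun _ => norm_nonneg _) hyf.norm).1 h0] with t ht
  exact sub_eq_zero.1 (norm_eq_zero.1 ht)

end Main

end RISpace

end

theorem mainTheorem3 {𝕜 : Type*} [RCLike 𝕜]
    {X : Type*} [NormedAddCommGroup X] [NormedSpace 𝕜 X]
    (ι : X →ₗ[𝕜] (unitInterval →ₘ[(volume : Measure unitInterval)] 𝕜))
    (hX : RISpace.IsRearrangementInvariant ι)
    (hsep : TopologicalSpace.SeparableSpace X)
    (hlush : RISpace.IsLush 𝕜 X) :
    Set.range ι = {f : unitInterval →ₘ[(volume : Measure unitInterval)] 𝕜 | Integrable f volume} ∧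
      ∀ x : X, ‖x‖ = ∫ t, ‖ι x t‖ ∂(volume : Measure unitInterval) := by
  have hnorm := RISpace.norm_eq_integral_norm hX hlush
  refine ⟨Set.Subset.antisymm ?_ fun f hf => RISpace.exists_of_integrable hX hnorm hf, hnorm⟩
  rintro _ ⟨x, rfl⟩
  exact hX.integrable x
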